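/- Let $x\in\mathbb{R}^n$ be arbitrary, let $a_1,\dots,a_m$ be independent $\mathcal N(0,I_n)$ random vectors in $\mathbb{R}^n$, and put $y_i=|\langle a_i,x\rangle|$. For $z\in\mathbb{R}^n$ put $\mathrm{dist}(z,x)=\min\{\|z-x\|,\|z+x\|\}$. The reshaped Wirtinger flow (RWF) algorithm with truncation thresholds $\alpha_l<\alpha_u$ and constant step size $\mu$ starts from $z^{(0)}=\lambda_0\tilde z$, where $$\lambda_0=\frac{mn}{\sum_{i=1}^m\|a_i\|_1}\cdot\frac1m\sum_{i=1}^m y_i$$ and $\tilde z$ is a unit eigenvector, for the largest eigenvalue, of $$Y=\frac1m\sum_{i=1}^m y_i\,a_ia_i^T\,\mathbf 1_{\{\alpha_l\lambda_0<y_i<\alpha_u\lambda_0\}},$$ and then iterates $$z^{(t+1)}=z^{(t)}-\frac{\mu}{m}\sum_{i=1}^m\Bigl(a_i^Tz^{(t)}-y_i\frac{a_i^Tz^{(t)}}{|a_i^Tz^{(t)}|}\Bigr)a_i ,\qquad \tfrac{0}{|0|}:=0 ,$$ the generalized-gradient step for the loss $\frac1{2m}\sum_{i=1}^m(|a_i^Tz|-y_i)^2$.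 Call the thresholds admissible if $0\le\alpha_l<\alpha_u$ and $\int_{\alpha_l}^{\alpha_u}(s^3-s)e^{-s^2/2}\,ds>0$; this holds whenever $1\le\alpha_l<\alpha_u$, in particular for the suggested values $\alpha_l=1$, $\alpha_u=5$. Theorem. There are universal constants $\mu_0>0$, $0<\nu<1$ and $\lambda>0$ with $\lambda\mu_0<1$, and, for all admissible thresholds $\alpha_l,\alpha_u$, constants $c_0,c_1,c_2>0$ depending only on $\alpha_l,\alpha_u$ (hence universal for $\alpha_l=1$, $\alpha_u=5$), such that the following holds for all $m,n$, all $x\in\mathbb{R}^n$ and all $\mu$. If $m\ge c_0n$ and $0<\mu<\mu_0$, then with probability at least $1-c_1\exp(-c_2m)$, for every choice of the leading eigenvector $\tilde z$, the RWF iterates satisfy $$\mathrm{dist}(z^{(t)},x)\le\nu(1-\rho)^t\|x\|\qquad\text{for all } t\in\mathbb{N},\qquad\text{where }\rho=\lambda\mu\in(0,1).$$ -/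

import Mathlib

open MeasureTheory ProbabilityTheory

namespace RWF

/-- Distance up to a global sign: `min ‖z ± x‖`. -/
noncomputable def dist {n : ℕ} (z x : EuclideanSpace ℝ (Fin n)) : ℝ :=
  min ‖z - x‖ ‖z + x‖

/-- The `ℓ₁` norm of a vector of `ℝⁿ`. -/
noncomputable def l1Norm {n : ℕ} (v : EuclideanSpace ℝ (Fin n)) : ℝ := ∑ j, |v j|

/-- The magnitude measurements `y i = |⟨a i, x⟩|`. -/
noncomputable def measurements {m n : ℕ} (a : Fin m → EuclideanSpace ℝ (Fin n))
    (x : EuclideanSpace ℝ (Fin n)) (i : Fin m) : ℝ :=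
  |inner ℝ (a i) x|

/-- The norm estimate `λ₀ = (m n / ∑ i, ‖a i‖₁) * ((1 / m) ∑ i, y i)`. -/
noncomputable def normEstimate {m n : ℕ} (a : Fin m → EuclideanSpace ℝ (Fin n))
    (y : Fin m → ℝ) : ℝ :=
  ((m : ℝ) * n / ∑ i, l1Norm (a i)) * ((1 / (m : ℝ)) * ∑ i, y i)

open Classical in
/-- The matrix `Y = (1 / m) ∑ i, y i • a i (a i)ᵀ 1{α_l λ₀ < y i < α_u λ₀}`. -/
noncomputable def initMatrix {m n : ℕ} (αl αu : ℝ) (a : Fin m → EuclideanSpace ℝ (Fin n))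
    (y : Fin m → ℝ) : Matrix (Fin n) (Fin n) ℝ :=
  (1 / (m : ℝ)) • ∑ i,
    if αl * normEstimate a y < y i ∧ y i < αu * normEstimate a y
    then y i • Matrix.vecMulVec (a i).ofLp (a i).ofLp else 0

/-- `u` is a normalized leading eigenvector of `Y`: a unit eigenvector for the largest
eigenvalue. -/
def IsLeadingEigenvector {n : ℕ} (Y : Matrix (Fin n) (Fin n) ℝ)
    (u : EuclideanSpace ℝ (Fin n)) : Prop :=
  ‖u‖ = 1 ∧ ∃ θ : ℝ, Module.End.HasEigenvector (Matrix.toEuclideanLin Y) θ u ∧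
    ∀ θ' : ℝ, Module.End.HasEigenvalue (Matrix.toEuclideanLin Y) θ' → θ' ≤ θ

/-- The generalized gradient of the loss `(1 / (2 m)) ∑ i, (|⟨a i, z⟩| - y i) ^ 2`, in which
`0 / |0| = 0`. -/
noncomputable def grad {m n : ℕ} (a : Fin m → EuclideanSpace ℝ (Fin n)) (y : Fin m → ℝ)
    (z : EuclideanSpace ℝ (Fin n)) : EuclideanSpace ℝ (Fin n) :=
  (1 / (m : ℝ)) • ∑ i,
    (inner ℝ (a i) z - y i * (inner ℝ (a i) z / |inner ℝ (a i) z|)) • a i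

/-- The iterates of the algorithm with step size `μ`, when `u` is the leading eigenvector used
in the initialization. -/
noncomputable def iterate {m n : ℕ} (μ : ℝ) (a : Fin m → EuclideanSpace ℝ (Fin n))
    (y : Fin m → ℝ) (u : EuclideanSpace ℝ (Fin n)) : ℕ → EuclideanSpace ℝ (Fin n)
  | 0 => normEstimate a y • u
  | t + 1 => iterate μ a y u t - μ • grad a y (iterate μ a y u t)

/-- Truncation thresholds for which `x` is the direction of the leading eigenvector of the
expectation of the initialization matrix: for a standard normal `ξ`,
`E[(|ξ|^3 - |ξ|) 1{α_l < |ξ| < α_u}] > 0` (up to the normalizing factor). All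
`1 ≤ α_l < α_u` are such. -/
def AdmissibleThresholds (αl αu : ℝ) : Prop :=
  0 ≤ αl ∧ αl < αu ∧ 0 < ∫ s in αl..αu, (s ^ 3 - s) * Real.exp (-s ^ 2 / 2)

end RWF

/-! Write `h = z - x`, `p i = ⟨a i, h⟩`, `q i = ⟨a i, x⟩`. The gradient at `z` is the average of `(p
i + r i) • a i`, where the sign error `r i` vanishes unless `|q i| ≤ |p i|`, and then `|r i| ≤ 2 |p
i|`. Without sign errors this is linear least squares with a well-conditioned Gaussian frame. Close
to `x`, the indices with `|q i| ≤ |p i|` carry only a small part of `∑ p i ^ 2`, so `⟨grad, h⟩ ≥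
‖h‖² / 4` and `‖grad‖ ≤ 24 ‖h‖`. A small step therefore shrinks `‖h‖` by the factor `1 - μ / 8`
(`norm_sub_smul_grad_sub_le`).

The probabilistic input is three bounds uniform over directions: `holdsWHP_frame_upper`,
`holdsWHP_frame_lower` and `exists_holdsWHP_sign`. Each combines a Chernoff bound for functions of
quadratic growth, a union bound over a net of the sphere, and a perturbation from the net to the
sphere. The last one also fixes the radius `ν` of the basin of contraction.

It remains to start inside the basin. The estimate `λ₀` is a quotient of two averages concentrating
at proportional values, so it is close to `‖x‖`. With thresholds relative to `‖x‖`, the expectation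
of `Y` is proportional to a matrix with one value along `x` (`signalMoment`) and one across it
(`noiseMoment`); admissibility says that the first is larger. Since the true thresholds involve the
random `λ₀`, the quadratic form is sandwiched between those of a slightly narrower and a slightly
wider deterministic window, and the gap forces the leading eigenvector towards `±x`
(`one_sub_sq_inner_le`). -/

namespace RWF

/-! ### Nets of balls and spheres. -/

section Nets

variable {E : Type*} [NormedAddCommGroup E] [NormedSpace ℝ E] [FiniteDimensional ℝ E]

/-- A 1-separated subset of the ball of radius 2 has at most `5 ^ dim` points by volume comparison;
one of maximal cardinality is a net, since an uncovered point could be added. -/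
lemma exists_one_net_closedBall_two :
    ∃ T : Finset E, T.card ≤ 5 ^ Module.finrank ℝ E ∧
      ∀ g : E, ‖g‖ ≤ 2 → ∃ s ∈ T, ‖g - s‖ ≤ 1 := by
  classical
  let Q : ℕ → Prop := fun k => ∃ s : Finset E, s.card = k ∧ (∀ c ∈ s, ‖c‖ ≤ 2) ∧
    ∀ c ∈ s, ∀ d ∈ s, c ≠ d → 1 ≤ ‖c - d‖
  have hQ0 : Q 0 := ⟨∅, by simp⟩
  obtain ⟨s, hs, hs2, hsep⟩ :=
    Nat.findGreatest_spec (P := Q) (Nat.zero_le (5 ^ Module.finrank ℝ E)) hQ0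
  refine ⟨s, hs ▸ Nat.findGreatest_le _, fun g hg => ?_⟩
  by_contra! hcon
  have hgs : g ∉ s := fun h => by
    have := hcon g h
    simp at this
    linarith
  have hQ : Q (s.card + 1) := by
    refine ⟨insert g s, Finset.card_insert_of_notMem hgs, ?_, ?_⟩
    · intro c hc
      rcases Finset.mem_insert.1 hc with rfl | hc
      · exact hg
      · exact hs2 c hc
    · intro c hc d hd hcd
      rcases Finset.mem_insert.1 hc with hc' | hc' <;>
        rcases Finset.mem_insert.1 hd with hd' | hd'
      · exact absurd (hc'.trans hd'.symm) hcd
      · rw [hc']; exact (hcon d hd').le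
      · rw [hd', norm_sub_rev]; exact (hcon c hc').le
      · exact hsep c hc' d hd' hcd
  have hle : s.card + 1 ≤ 5 ^ Module.finrank ℝ E := by
    obtain ⟨t, ht, ht2, htsep⟩ := hQ
    exact ht ▸ Besicovitch.card_le_of_separated t ht2 htsep
  have := Nat.le_findGreatest hle hQ
  omega

/-- Each step halves the mesh at the price of a factor `5 ^ dim`: the remainder `g - s`, rescaled by
`2 ^ (k + 1)`, lies in the ball of radius 2 and is covered by the previous net. -/
lemma exists_net_closedBall_one (k : ℕ) :
    ∃ T : Finset E, T.card ≤ (5 ^ k) ^ Module.finrank ℝ E ∧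
      ∀ g : E, ‖g‖ ≤ 1 → ∃ s ∈ T, ‖g - s‖ ≤ (1 / 2) ^ k := by
  classical
  induction k with
  | zero => exact ⟨{0}, by simp, fun g hg => ⟨0, by simp, by simpa using hg⟩⟩
  | succ k ih =>
    obtain ⟨S, hS, hSn⟩ := ih
    obtain ⟨T, hT, hTn⟩ := exists_one_net_closedBall_two (E := E)
    refine ⟨(S ×ˢ T).image fun q => q.1 + ((1 / 2 : ℝ) ^ (k + 1)) • q.2, ?_, ?_⟩
    · refine Finset.card_image_le.trans ?_
      rw [Finset.card_product, pow_succ, mul_pow]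
      exact Nat.mul_le_mul hS hT
    · intro g hg
      obtain ⟨s, hs, hgs⟩ := hSn g hg
      obtain ⟨t, ht, hgt⟩ := hTn ((2 : ℝ) ^ (k + 1) • (g - s)) (by
        rw [norm_smul, Real.norm_of_nonneg (by positivity)]
        calc (2 : ℝ) ^ (k + 1) * ‖g - s‖ ≤ 2 ^ (k + 1) * (1 / 2) ^ k := by gcongr
          _ = 2 := by rw [pow_succ, one_div, inv_pow]; field_simp)
      refine ⟨_, Finset.mem_image.2 ⟨(s, t), Finset.mem_product.2 ⟨hs, ht⟩, rfl⟩, ?_⟩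
      have h : g - (s + ((1 / 2 : ℝ) ^ (k + 1)) • t)
          = ((1 / 2 : ℝ) ^ (k + 1)) • ((2 : ℝ) ^ (k + 1) • (g - s) - t) := by
        rw [smul_sub, smul_smul, ← mul_pow]
        norm_num
        abel
      simp only
      rw [h, norm_smul, Real.norm_of_nonneg (by positivity)]
      exact mul_le_of_le_one_right (by positivity) hgt

end Nets

/-- The unit sphere of `ℝⁿ` has a `δ`-net of at most exponential cardinality in `n`. -/
lemma exists_net_sphere {δ : ℝ} (hδ : 0 < δ) :
    ∃ N : ℕ, 0 < N ∧ ∀ n : ℕ, ∃ T : Finset (EuclideanSpace ℝ (Fin n)), T.card ≤ N ^ n ∧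
      (∀ s ∈ T, ‖s‖ = 1) ∧
      ∀ g : EuclideanSpace ℝ (Fin n), ‖g‖ = 1 → ∃ s ∈ T, ‖g - s‖ ≤ δ := by
  classical
  obtain ⟨k, hk⟩ := exists_pow_lt_of_lt_one (half_pos hδ) (by norm_num : (1 / 2 : ℝ) < 1)
  refine ⟨5 ^ k, by positivity, fun n => ?_⟩
  obtain ⟨T, hT, hTn⟩ := exists_net_closedBall_one (E := EuclideanSpace ℝ (Fin n)) k
  rw [finrank_euclideanSpace_fin] at hT
  -- Net points near the sphere are moved onto it. This at most doubles the mesh, whence `δ / 2` in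
  -- the choice of `k`.
  let R : EuclideanSpace ℝ (Fin n) → Prop := fun s => ∃ g, ‖g‖ = 1 ∧ ‖g - s‖ ≤ (1 / 2 : ℝ) ^ k
  let F : EuclideanSpace ℝ (Fin n) → EuclideanSpace ℝ (Fin n) :=
    fun s => if h : R s then h.choose else 0
  have hF : ∀ s, R s → ‖F s‖ = 1 ∧ ‖F s - s‖ ≤ (1 / 2 : ℝ) ^ k := fun s h => by
    simp only [F, dif_pos h]
    exact h.choose_spec
  refine ⟨(T.filter R).image F, Finset.card_image_le.trans ((Finset.card_filter_le _ _).trans hT),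
    ?_, ?_⟩
  · intro s hs
    obtain ⟨t, ht, rfl⟩ := Finset.mem_image.1 hs
    exact (hF t (Finset.mem_filter.1 ht).2).1
  · intro g hg
    obtain ⟨s, hs, hgs⟩ := hTn g hg.le
    have hR : R s := ⟨g, hg, hgs⟩
    refine ⟨F s, Finset.mem_image_of_mem _ (Finset.mem_filter.2 ⟨hs, hR⟩), ?_⟩
    calc ‖g - F s‖ = ‖(g - s) - (F s - s)‖ := by congr 1; abel
      _ ≤ ‖g - s‖ + ‖F s - s‖ := norm_sub_le _ _
      _ ≤ δ := by linarith [(hF s hR).2]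

/-! ### Deterministic contraction of one gradient step. -/

section Contraction

/-- If `|p| < |q|`, then `p + q` is nonzero and has the sign of `q`, so the error vanishes;
otherwise it is at most `2 |q| ≤ 2 |p|`. The value `0 / |0| = 0` respects this bound. -/
lemma abs_sub_abs_mul_sign_le (p q : ℝ) :
    |q - |q| * ((p + q) / |p + q|)| ≤ 2 * (if |q| ≤ |p| then |p| else 0) := by
  split_ifs with h
  · have h1 (t : ℝ) : abs (t / |t|) ≤ 1 := by
      rw [abs_div, abs_abs]; exact div_self_le_one _
    have h2 : |(|q| * ((p + q) / |p + q|))| ≤ |q| * 1 := by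
      rw [abs_mul, abs_abs]; gcongr; exact h1 _
    have h3 := abs_sub_le q 0 (|q| * ((p + q) / |p + q|))
    rw [sub_zero, zero_sub, abs_neg] at h3
    linarith
  · push Not at h
    have : q - |q| * ((p + q) / |p + q|) = 0 := by
      rcases lt_trichotomy q 0 with hq | hq | hq
      · have : p + q < 0 := by
          rw [abs_of_neg hq] at h; linarith [le_abs_self p]
        rw [abs_of_neg this, abs_of_neg hq, div_neg, div_self this.ne]
        ring
      · subst hq; simp at h; linarith [abs_nonneg p]
      · have : 0 < p + q := by
          rw [abs_of_pos hq] at h; linarith [neg_abs_le p]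
        rw [abs_of_pos this, abs_of_pos hq, div_self this.ne']
        ring
    simp [this]

variable {m n : ℕ}

/-- The gradient is a contraction towards `x` in a neighbourhood of `x`. -/
lemma norm_sub_smul_grad_sub_le {a : Fin m → EuclideanSpace ℝ (Fin n)}
    {y : Fin m → ℝ} {x z : EuclideanSpace ℝ (Fin n)} {μ : ℝ} (hm : 0 < m)
    (hμ : 0 < μ) (hμ' : μ < 1 / 2304) (hy : ∀ i, y i = |inner ℝ (a i) x|)
    (hU : ∀ g, ∑ i, (inner ℝ (a i) g) ^ 2 ≤ 8 * m * ‖g‖ ^ 2)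
    (hL : ∀ g, (m / 2) * ‖g‖ ^ 2 ≤ ∑ i, (inner ℝ (a i) g) ^ 2)
    (hS : ∑ i, (if |inner ℝ (a i) x| ≤ |inner ℝ (a i) (z - x)|
      then (inner ℝ (a i) (z - x)) ^ 2 else 0) ≤ (m / 8) * ‖z - x‖ ^ 2) :
    ‖z - μ • grad a y z - x‖ ≤ (1 - 1 / 8 * μ) * ‖z - x‖ := by
  set h := z - x with hh
  set G := grad a y z with hG
  let p : Fin m → ℝ := fun i => inner ℝ (a i) h
  let q : Fin m → ℝ := fun i => inner ℝ (a i) x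
  let r : Fin m → ℝ := fun i => q i - |q i| * ((p i + q i) / |p i + q i|)
  have hm' : (0 : ℝ) < m := by exact_mod_cast hm
  have hpq : ∀ i, inner ℝ (a i) z = p i + q i := fun i => by
    simp only [p, q, hh, inner_sub_right]; ring
  have hinner : ∀ v, inner ℝ G v = (1 / m) * ∑ i, (p i + r i) * inner ℝ (a i) v := fun v => by
    simp only [hG, grad, inner_smul_left, sum_inner, hpq, hy]
    simp only [conj_trivial]
    congr 1
    refine Finset.sum_congr rfl fun i _ => ?_
    simp only [r, q]
    ring
  have hr : ∀ i, |r i| ≤ 2 * (if |q i| ≤ |p i| then |p i| else 0) :=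
    fun i => abs_sub_abs_mul_sign_le _ _
  have hpr : ∀ i, p i ^ 2 - 2 * (if |q i| ≤ |p i| then p i ^ 2 else 0) ≤ (p i + r i) * p i := by
    intro i
    have h1 : |r i * p i| ≤ 2 * (if |q i| ≤ |p i| then p i ^ 2 else 0) := by
      rw [abs_mul]
      refine (mul_le_mul_of_nonneg_right (hr i) (abs_nonneg _)).trans (le_of_eq ?_)
      split_ifs
      · rw [← sq_abs (p i)]; ring
      · ring
    nlinarith [neg_abs_le (r i * p i)]
  have hpr2 : ∀ i, (p i + r i) ^ 2 ≤ 9 * p i ^ 2 := by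
    intro i
    have h1 : |r i| ≤ 2 * |p i| := (hr i).trans (by split_ifs <;> simp)
    have h2 : |p i + r i| ≤ 3 * |p i| := (abs_add_le _ _).trans (by linarith)
    calc (p i + r i) ^ 2 = |p i + r i| ^ 2 := (sq_abs _).symm
      _ ≤ (3 * |p i|) ^ 2 := by gcongr
      _ = 9 * p i ^ 2 := by rw [mul_pow, sq_abs]; norm_num
  -- The constant is `1 / 2 - 2 * (1 / 8)`: the lower frame bound minus twice the sign-error share.
  have hlow : 1 / 4 * ‖h‖ ^ 2 ≤ inner ℝ G h := by
    rw [hinner, one_div_mul_eq_div (m : ℝ), le_div_iff₀ hm']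
    have h1 : ∑ i, (p i ^ 2 - 2 * (if |q i| ≤ |p i| then p i ^ 2 else 0))
        ≤ ∑ i, (p i + r i) * p i := Finset.sum_le_sum fun i _ => hpr i
    rw [Finset.sum_sub_distrib, ← Finset.mul_sum] at h1
    have h2 := hL h
    change _ ≤ ∑ i, (p i) ^ 2 at h2
    change ∑ i, (if |q i| ≤ |p i| then p i ^ 2 else 0) ≤ _ at hS
    change _ ≤ ∑ i, (p i + r i) * p i
    linarith
  have hup : ‖G‖ ^ 2 ≤ 576 * ‖h‖ ^ 2 := by
    have h1 : ‖G‖ ^ 2 = (1 / m) * ∑ i, (p i + r i) * inner ℝ (a i) G := by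
      rw [← hinner, real_inner_self_eq_norm_sq]
    have h2 := Finset.sum_mul_sq_le_sq_mul_sq Finset.univ (fun i => p i + r i)
      (fun i => inner ℝ (a i) G)
    have h3 : ∑ i, (p i + r i) ^ 2 ≤ 72 * m * ‖h‖ ^ 2 := by
      calc ∑ i, (p i + r i) ^ 2 ≤ ∑ i, 9 * p i ^ 2 := Finset.sum_le_sum fun i _ => hpr2 i
        _ = 9 * ∑ i, p i ^ 2 := by rw [Finset.mul_sum]
        _ ≤ 9 * (8 * m * ‖h‖ ^ 2) := by gcongr; exact hU h
        _ = _ := by ring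
    -- Cauchy–Schwarz and the frame bound applied to `G` itself; one factor `‖G‖ ^ 2` then cancels,
    -- leaving `576 = 72 * 8`.
    have h4 : (m * ‖G‖ ^ 2) ^ 2 ≤ (72 * m * ‖h‖ ^ 2) * (8 * m * ‖G‖ ^ 2) := by
      have : (m * ‖G‖ ^ 2) = ∑ i, (p i + r i) * inner ℝ (a i) G := by
        rw [h1]; field_simp
      rw [this]
      refine h2.trans ?_
      exact mul_le_mul h3 (hU G) (Finset.sum_nonneg fun _ _ => sq_nonneg _) (by positivity)
    rcases (sq_nonneg ‖G‖).eq_or_lt with h0 | h0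
    · rw [← h0]; positivity
    · have h5 : (m ^ 2 * ‖G‖ ^ 2) * ‖G‖ ^ 2 ≤ (m ^ 2 * ‖G‖ ^ 2) * (576 * ‖h‖ ^ 2) := by
        linarith
      exact le_of_mul_le_mul_left h5 (by positivity)
  -- Expanding gives the factor `1 - μ / 2 + 576 μ²`. Since `μ < 1 / 2304 = 1 / (4 * 576)`, this is
  -- at most `1 - μ / 4 ≤ (1 - μ / 8) ^ 2`.
  have hfin : ‖h - μ • G‖ ^ 2 ≤ ((1 - 1 / 8 * μ) * ‖h‖) ^ 2 := by
    rw [norm_sub_sq_real, inner_smul_right, real_inner_comm, norm_smul, Real.norm_of_nonneg hμ.le,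
      mul_pow, mul_pow]
    have h1 : μ * (1 / 4 * ‖h‖ ^ 2) ≤ μ * inner ℝ G h := by gcongr
    have h2 : μ ^ 2 * ‖G‖ ^ 2 ≤ μ ^ 2 * (576 * ‖h‖ ^ 2) := by gcongr
    have h3 : 0 ≤ (μ * (1 / 2304 - μ)) * ‖h‖ ^ 2 :=
      mul_nonneg (mul_nonneg hμ.le (by linarith)) (sq_nonneg _)
    have h4 : 0 ≤ μ ^ 2 * ‖h‖ ^ 2 := by positivity
    nlinarith
  have : z - μ • G - x = h - μ • G := by rw [hh]; abel
  rw [this]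
  exact le_of_sq_le_sq hfin (mul_nonneg (by linarith) (norm_nonneg _))

end Contraction

/-! ### Chernoff bounds and the union bound. -/

section Chernoff

lemma exp_le_one_add_add_sq_mul_exp_abs (y : ℝ) :
    Real.exp y ≤ 1 + y + y ^ 2 * Real.exp |y| := by
  have h1 : Real.exp y - 1 ≤ y * Real.exp y := by
    have h := Real.add_one_le_exp (-y)
    have h2 : Real.exp y * Real.exp (-y) = 1 := by rw [← Real.exp_add]; simp
    nlinarith [Real.exp_pos y]
  rcases le_total 0 y with hy | hy
  · rw [abs_of_nonneg hy]
    nlinarith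
  · have h2 := Real.add_one_le_exp y
    have h3 : 1 ≤ Real.exp |y| := Real.one_le_exp (abs_nonneg y)
    nlinarith [sq_nonneg y]

/-- The exponential rate in the Chernoff bound for variables `X` with `E exp (s |X|) ≤ M` and
deviation `δ` of the average. -/
noncomputable def chernoffRate (s M δ : ℝ) : ℝ := δ / 2 * min (s / 2) (δ * s ^ 2 / (16 * M))

lemma chernoffRate_pos {s M δ : ℝ} (hs : 0 < s) (hM : 0 < M) (hδ : 0 < δ) :
    0 < chernoffRate s M δ := by
  unfold chernoffRate
  positivity

/-- Half of the available exponential moment pays for the quadratic factor in the second-order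
expansion of the moment generating function; the condition `t ≤ s / 2` leaves the other half for
`exp (t |f|)`. -/
lemma sq_le_exp_mul {s u : ℝ} (hs : 0 < s) (hu : 0 ≤ u) :
    u ^ 2 ≤ 8 / s ^ 2 * Real.exp (s * u / 2) := by
  have h := Real.quadratic_le_exp_of_nonneg (x := s * u / 2) (by positivity)
  have h2 : (s * u / 2) ^ 2 / 2 ≤ Real.exp (s * u / 2) := by
    have : 0 ≤ s * u / 2 := by positivity
    linarith
  rw [div_mul_eq_mul_div, le_div_iff₀ (by positivity)]
  nlinarith

variable {X : Type*} [MeasurableSpace X] {γ : Measure X} {f : X → ℝ}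

lemma integrable_of_integrable_exp {s : ℝ} (hs : 0 < s) (hf : Measurable f)
    (hint : Integrable (fun x => Real.exp (s * |f x|)) γ) : Integrable f γ := by
  refine Integrable.mono' (hint.const_mul (1 / s)) hf.aestronglyMeasurable (ae_of_all _ fun x => ?_)
  have := Real.add_one_le_exp (s * |f x|)
  rw [Real.norm_eq_abs, one_div_mul_eq_div s, le_div_iff₀ hs]
  linarith

lemma mgf_le_of_integrable_exp [IsProbabilityMeasure γ] {s M b t : ℝ} (hs : 0 < s) (hf : Measurable f)
    (hint : Integrable (fun x => Real.exp (s * |f x|)) γ) (hM : ∫ x, Real.exp (s * |f x|) ∂γ ≤ M)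
    (hb : ∫ x, f x ∂γ ≤ b) (ht : 0 ≤ t) (hts : t ≤ s / 2) :
    Integrable (fun x => Real.exp (t * f x)) γ ∧
      mgf f γ t ≤ Real.exp (t * b + t ^ 2 * (8 * M / s ^ 2)) := by
  have hi : Integrable (fun x => Real.exp (t * f x)) γ := by
    refine hint.mono' (by fun_prop) (ae_of_all _ fun x => ?_)
    rw [Real.norm_of_nonneg (Real.exp_pos _).le, Real.exp_le_exp]
    calc t * f x ≤ t * |f x| := by gcongr; exact le_abs_self _
      _ ≤ s * |f x| := by gcongr; linarith
  have hfi := integrable_of_integrable_exp hs hf hint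
  refine ⟨hi, ?_⟩
  have hpt : ∀ x, Real.exp (t * f x)
      ≤ 1 + t * f x + t ^ 2 * (8 / s ^ 2) * Real.exp (s * |f x|) := by
    intro x
    refine (exp_le_one_add_add_sq_mul_exp_abs _).trans ?_
    rw [abs_mul, abs_of_nonneg ht, mul_pow, ← sq_abs (f x), mul_assoc, mul_assoc]
    have h1 := sq_le_exp_mul hs (abs_nonneg (f x))
    have h2 : |f x| ^ 2 * Real.exp (t * |f x|) ≤ 8 / s ^ 2 * Real.exp (s * |f x|) := by
      calc |f x| ^ 2 * Real.exp (t * |f x|)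
          ≤ (8 / s ^ 2 * Real.exp (s * |f x| / 2)) * Real.exp (s * |f x| / 2) := by
            gcongr
            nlinarith [abs_nonneg (f x)]
        _ = 8 / s ^ 2 * Real.exp (s * |f x|) := by
            rw [mul_assoc, ← Real.exp_add]; congr 2; ring
    gcongr
  calc mgf f γ t ≤ ∫ x, (1 + t * f x + t ^ 2 * (8 / s ^ 2) * Real.exp (s * |f x|)) ∂γ :=
        integral_mono hi (((integrable_const _).add (hfi.const_mul _)).add (hint.const_mul _)) hpt
    _ = 1 + t * ∫ x, f x ∂γ + t ^ 2 * (8 / s ^ 2) * ∫ x, Real.exp (s * |f x|) ∂γ := by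
        rw [integral_add (f := fun x => 1 + t * f x) ((integrable_const _).add (hfi.const_mul _))
          (hint.const_mul _), integral_add (integrable_const _) (hfi.const_mul _),
          integral_const_mul, integral_const_mul]
        simp
    _ ≤ 1 + t * b + t ^ 2 * (8 / s ^ 2) * M := by gcongr
    _ ≤ Real.exp (t * b + t ^ 2 * (8 * M / s ^ 2)) := by
        have := Real.add_one_le_exp (t * b + t ^ 2 * (8 * M / s ^ 2))
        refine le_trans (le_of_eq ?_) this
        ring

/-- Chernoff bound for an average of independent copies of a variable with an exponential
moment. -/
lemma measure_sum_ge_le_exp_chernoffRate [IsProbabilityMeasure γ] {Ω : Type*} [MeasurableSpace Ω] {P : Measure Ω}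
    [IsProbabilityMeasure P] {m : ℕ} {a : Fin m → Ω → X} (ha : ∀ i, HasLaw (a i) γ P)
    (hind : iIndepFun a P) {s M b δ : ℝ} (hs : 0 < s) (hM0 : 0 < M) (hδ : 0 < δ)
    (hf : Measurable f)
    (hint : Integrable (fun x => Real.exp (s * |f x|)) γ) (hM : ∫ x, Real.exp (s * |f x|) ∂γ ≤ M)
    (hb : ∫ x, f x ∂γ ≤ b) :
    P.real {ω | m * (b + δ) ≤ ∑ i, f (a i ω)} ≤ Real.exp (-chernoffRate s M δ * m) := by
  set t := min (s / 2) (δ * s ^ 2 / (16 * M)) with ht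
  have ht0 : 0 < t := by rw [ht]; positivity
  obtain ⟨hi, hmgf⟩ := mgf_le_of_integrable_exp hs hf hint hM hb ht0.le (min_le_left _ _)
  have hindf : iIndepFun (fun i => f ∘ a i) P := hind.comp (fun _ => f) fun _ => hf
  have hmeas : ∀ i, AEMeasurable (f ∘ a i) P := fun i => hf.comp_aemeasurable (ha i).aemeasurable
  have hmgfi : ∀ i, mgf (f ∘ a i) P t = mgf f γ t := fun i => by
    unfold mgf
    exact (ha i).integral_comp (f := fun x => Real.exp (t * f x)) (by fun_prop)
  -- If this failed, the `mgf` of the sum would be its default value 0, whereas it is a product of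
  -- positive factors.
  have hsumint : Integrable (fun ω => Real.exp (t * (∑ i, f ∘ a i) ω)) P := by
    by_contra hcon
    have h1 := hindf.mgf_sum₀ hmeas Finset.univ (t := t)
    rw [mgf_undef hcon] at h1
    have h2 : 0 < ∏ i : Fin m, mgf (f ∘ a i) P t :=
      Finset.prod_pos fun i _ => by rw [hmgfi]; exact mgf_pos hi
    exact h2.ne h1
  have hch := measure_ge_le_exp_mul_mgf (μ := P) (X := ∑ i, f ∘ a i) (m * (b + δ)) ht0.le hsumint
  rw [hindf.mgf_sum₀ hmeas] at hch
  simp only [hmgfi, Finset.prod_const, Finset.card_univ, Fintype.card_fin, Finset.sum_apply,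
    Function.comp_apply] at hch
  refine hch.trans ?_
  calc Real.exp (-t * (m * (b + δ))) * mgf f γ t ^ m
      ≤ Real.exp (-t * (m * (b + δ))) * Real.exp (t * b + t ^ 2 * (8 * M / s ^ 2)) ^ m := by
        gcongr
        exact mgf_nonneg
    _ = Real.exp (m * (t * (t * (8 * M / s ^ 2) - δ))) := by
        rw [← Real.exp_nat_mul, ← Real.exp_add]; congr 1; ring
    _ ≤ Real.exp (-chernoffRate s M δ * m) := by
        rw [Real.exp_le_exp, chernoffRate, ← ht]
        -- The second term in the minimum defining `t` makes the quadratic term consume at most half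
        -- of the gain `t * δ`.
        have h1 : t * (8 * M / s ^ 2) ≤ δ / 2 := by
          calc t * (8 * M / s ^ 2) ≤ (δ * s ^ 2 / (16 * M)) * (8 * M / s ^ 2) := by
                gcongr; exact min_le_right _ _
            _ = δ / 2 := by field_simp; norm_num
        have h2 : t * (t * (8 * M / s ^ 2) - δ) ≤ t * (-(δ / 2)) := by gcongr; linarith
        have h3 : (m : ℝ) * (t * (t * (8 * M / s ^ 2) - δ)) ≤ m * (t * (-(δ / 2))) := by gcongr
        linarith

end Chernoff

lemma pow_mul_exp_le {N n m : ℕ} {c : ℝ} (hN : 0 < N) (hc : 0 < c)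
    (h : 2 * Real.log N / c * n ≤ m) :
    (N : ℝ) ^ n * Real.exp (-c * m) ≤ Real.exp (-(c / 2) * m) := by
  have hN' : (0 : ℝ) < N := by exact_mod_cast hN
  rw [div_mul_eq_mul_div, div_le_iff₀ hc] at h
  have h1 : (N : ℝ) ^ n = Real.exp (n * Real.log N) := by
    rw [Real.exp_nat_mul, Real.exp_log hN']
  rw [h1, ← Real.exp_add, Real.exp_le_exp]
  linarith

/-- Union bound over a finite set of exponential cardinality. -/
lemma measure_exists_mem_le {Ω ι : Type*} [MeasurableSpace Ω] {P : Measure Ω}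
    [IsProbabilityMeasure P] {N n m : ℕ} {c : ℝ} (hN : 0 < N) (hc : 0 < c)
    (h : 2 * Real.log N / c * n ≤ m) {T : Finset ι} (hT : T.card ≤ N ^ n) {B : ι → Set Ω}
    (hB : ∀ s ∈ T, P.real (B s) ≤ Real.exp (-c * m)) :
    P.real {ω | ∃ s ∈ T, ω ∈ B s} ≤ Real.exp (-(c / 2) * m) := by
  have h1 : {ω | ∃ s ∈ T, ω ∈ B s} = ⋃ s ∈ T, B s := by ext; simp
  rw [h1]
  calc P.real (⋃ s ∈ T, B s) ≤ ∑ s ∈ T, P.real (B s) := measureReal_biUnion_finset_le _ _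
    _ ≤ ∑ _s ∈ T, Real.exp (-c * m) := Finset.sum_le_sum hB
    _ = T.card * Real.exp (-c * m) := by simp
    _ ≤ (N : ℝ) ^ n * Real.exp (-c * m) := by gcongr; exact_mod_cast hT
    _ ≤ _ := pow_mul_exp_le hN hc h

/-! ### Gaussian integrals, truncated moments and the spectral gap. -/

section Gaussian

lemma integrable_exp_sq_div_four :
    Integrable (fun t : ℝ => Real.exp (t ^ 2 / 4)) (gaussianReal 0 1) := by
  rw [gaussianReal_of_var_ne_zero _ one_ne_zero,
    integrable_withDensity_iff_integrable_smul₀' (by fun_prop)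
      (ae_of_all _ fun _ => gaussianPDF_lt_top)]
  have h := (integrable_exp_neg_mul_sq (b := 1 / 4) (by norm_num)).const_mul
    ((Real.sqrt (2 * Real.pi))⁻¹)
  refine h.congr (ae_of_all _ fun t => ?_)
  simp only [toReal_gaussianPDF, gaussianPDFReal, smul_eq_mul]
  rw [mul_assoc, ← Real.exp_add]
  simp only [NNReal.coe_one, mul_one, sub_zero]
  congr 2
  ring

/-- The exact value is `√2`. -/
lemma integral_exp_sq_div_four_le :
    ∫ t : ℝ, Real.exp (t ^ 2 / 4) ∂(gaussianReal 0 1) ≤ 2 := by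
  rw [integral_gaussianReal_eq_integral_smul one_ne_zero]
  have h : ∀ t : ℝ, gaussianPDFReal 0 1 t • Real.exp (t ^ 2 / 4)
      = (Real.sqrt (2 * Real.pi))⁻¹ * Real.exp (-(1 / 4) * t ^ 2) := fun t => by
    simp only [gaussianPDFReal, smul_eq_mul]
    rw [mul_assoc, ← Real.exp_add]
    simp only [NNReal.coe_one, mul_one, sub_zero]
    congr 2
    ring
  simp_rw [h]
  rw [integral_const_mul, integral_gaussian, inv_mul_eq_div, ← Real.sqrt_div' _ (by positivity)]
  rw [Real.sqrt_le_left (by norm_num)]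
  rw [div_le_iff₀ (by positivity)]
  nlinarith [Real.pi_pos]

variable {n : ℕ}

local notation "ℝⁿ" => EuclideanSpace ℝ (Fin n)

lemma hasLaw_inner {g : ℝⁿ} (hg : ‖g‖ = 1) :
    HasLaw (fun v : ℝⁿ => inner ℝ v g) (gaussianReal 0 1) (stdGaussian ℝⁿ) where
  aemeasurable := by fun_prop
  map_eq := by
    have h := IsGaussian.map_eq_gaussianReal (μ := stdGaussian ℝⁿ) (innerSL ℝ g)
    rw [integral_strongDual_stdGaussian, variance_dual_stdGaussian, innerSL_apply_norm, hg] at h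
    have h2 : (fun v : ℝⁿ => inner ℝ v g) = innerSL ℝ g := by
      ext v; simp [real_inner_comm]
    rw [h2, h]
    simp

/-- The two projections are jointly Gaussian with covariance `⟨g, h⟩ = 0`. -/
lemma indepFun_inner {g h : ℝⁿ} (hgh : inner ℝ g h = 0) :
    IndepFun (fun v : ℝⁿ => inner ℝ v g) (fun v : ℝⁿ => inner ℝ v h) (stdGaussian ℝⁿ) := by
  have hlaw : HasGaussianLaw (fun v : ℝⁿ => v) (stdGaussian ℝⁿ) := IsGaussian.hasGaussianLaw_id
  have h2 := hlaw.map_fun ((innerSL ℝ g).prod (innerSL ℝ h))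
  have h3 : HasGaussianLaw (fun v : ℝⁿ => (inner ℝ v g, inner ℝ v h)) (stdGaussian ℝⁿ) := by
    exact h2.congr (ae_of_all _ fun v => by simp [real_inner_comm])
  refine h3.indepFun_of_covariance_eq_zero ?_
  have h4 := covarianceBilin_apply_eq_cov (μ := stdGaussian ℝⁿ) IsGaussian.memLp_two_id g h
  rw [covarianceBilin_stdGaussian, innerSL_apply_apply, hgh] at h4
  simp_rw [fun u => real_inner_comm u g, fun u => real_inner_comm u h] at h4
  exact h4.symm

lemma integral_inner {g : ℝⁿ} (hg : ‖g‖ = 1) {f : ℝ → ℝ} (hf : Measurable f) :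
    ∫ v : ℝⁿ, f (inner ℝ v g) ∂(stdGaussian ℝⁿ) = ∫ t, f t ∂(gaussianReal 0 1) :=
  (hasLaw_inner hg).integral_comp (f := f) hf.aestronglyMeasurable

lemma integrable_inner {g : ℝⁿ} (hg : ‖g‖ = 1) {f : ℝ → ℝ} (hf : Integrable f (gaussianReal 0 1)) :
    Integrable (fun v : ℝⁿ => f (inner ℝ v g)) (stdGaussian ℝⁿ) := by
  have h : Integrable f ((stdGaussian ℝⁿ).map (fun v : ℝⁿ => inner ℝ v g)) := by
    rw [(hasLaw_inner hg).map_eq]; exact hf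
  exact h.comp_aemeasurable (hasLaw_inner hg).aemeasurable

/-- A function of quadratic growth in one direction has an exponential moment. -/
lemma integrable_exp_of_le_one_add_sq {g : ℝⁿ} (hg : ‖g‖ = 1) {f : ℝⁿ → ℝ} (hf : Measurable f)
    {W : ℝ} (hW : 0 < W) (hfW : ∀ v, |f v| ≤ W * (1 + (inner ℝ v g) ^ 2)) :
    Integrable (fun v => Real.exp (1 / (4 * W) * |f v|)) (stdGaussian ℝⁿ) ∧
      ∫ v, Real.exp (1 / (4 * W) * |f v|) ∂(stdGaussian ℝⁿ) ≤ 4 := by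
  have hint : Integrable (fun v : ℝⁿ => Real.exp ((inner ℝ v g) ^ 2 / 4)) (stdGaussian ℝⁿ) :=
    integrable_inner hg integrable_exp_sq_div_four
  have hle : ∀ v : ℝⁿ, Real.exp (1 / (4 * W) * |f v|)
      ≤ 2 * Real.exp ((inner ℝ v g) ^ 2 / 4) := by
    intro v
    have h1 : 1 / (4 * W) * |f v| ≤ 1 / 4 + (inner ℝ v g) ^ 2 / 4 := by
      calc 1 / (4 * W) * |f v| ≤ 1 / (4 * W) * (W * (1 + (inner ℝ v g) ^ 2)) := by
            gcongr; exact hfW v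
        _ = _ := by field_simp
    have h2 : Real.exp (1 / 4) ≤ 2 := by
      have := Real.exp_bound_div_one_sub_of_interval (x := 1 / 4) (by norm_num) (by norm_num)
      linarith
    calc _ ≤ Real.exp (1 / 4 + (inner ℝ v g) ^ 2 / 4) := Real.exp_le_exp.2 h1
      _ = Real.exp (1 / 4) * Real.exp ((inner ℝ v g) ^ 2 / 4) := Real.exp_add _ _
      _ ≤ _ := by gcongr
  have hi : Integrable (fun v => Real.exp (1 / (4 * W) * |f v|)) (stdGaussian ℝⁿ) := by
    refine (hint.const_mul 2).mono' (by fun_prop) (ae_of_all _ fun v => ?_)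
    rw [Real.norm_of_nonneg (Real.exp_pos _).le]
    exact hle v
  refine ⟨hi, (integral_mono hi (hint.const_mul 2) hle).trans ?_⟩
  rw [integral_const_mul, integral_inner hg (f := fun t => Real.exp (t ^ 2 / 4)) (by fun_prop)]
  linarith [integral_exp_sq_div_four_le]

lemma integrable_of_le_one_add_sq {g : ℝⁿ} (hg : ‖g‖ = 1) {f : ℝⁿ → ℝ} (hf : Measurable f)
    {W : ℝ} (hW : 0 < W) (hfW : ∀ v, |f v| ≤ W * (1 + (inner ℝ v g) ^ 2)) :
    Integrable f (stdGaussian ℝⁿ) :=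
  integrable_of_integrable_exp (by positivity) hf (integrable_exp_of_le_one_add_sq hg hf hW hfW).1

/-- The exponential rate in `measure_sum_ge_le`. -/
noncomputable def quadraticRate (W δ : ℝ) : ℝ := chernoffRate (1 / (4 * W)) 4 δ

lemma quadraticRate_pos {W δ : ℝ} (hW : 0 < W) (hδ : 0 < δ) : 0 < quadraticRate W δ :=
  chernoffRate_pos (by positivity) (by norm_num) hδ

/-- Upper tail of an average of a function of quadratic growth in one direction. -/
lemma measure_sum_ge_le {Ω : Type*} [MeasurableSpace Ω] {P : Measure Ω}
    [IsProbabilityMeasure P] {m : ℕ} {a : Fin m → Ω → ℝⁿ}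
    (ha : ∀ i, HasLaw (a i) (stdGaussian ℝⁿ) P) (hind : iIndepFun a P)
    {g : ℝⁿ} (hg : ‖g‖ = 1) {f : ℝⁿ → ℝ} (hf : Measurable f)
    {W b δ : ℝ} (hW : 0 < W) (hδ : 0 < δ) (hfW : ∀ v, |f v| ≤ W * (1 + (inner ℝ v g) ^ 2))
    (hb : ∫ v, f v ∂(stdGaussian ℝⁿ) ≤ b) :
    P.real {ω | m * (b + δ) ≤ ∑ i, f (a i ω)} ≤ Real.exp (-quadraticRate W δ * m) :=
  measure_sum_ge_le_exp_chernoffRate ha hind (by positivity) (by norm_num) hδ hf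
    (integrable_exp_of_le_one_add_sq hg hf hW hfW).1
    (integrable_exp_of_le_one_add_sq hg hf hW hfW).2 hb

lemma integral_sq_gaussianReal : ∫ t : ℝ, t ^ 2 ∂(gaussianReal 0 1) = 1 := by
  have h := variance_id_gaussianReal (μ := 0) (v := 1)
  rw [variance_of_integral_eq_zero (by fun_prop) (by simp)] at h
  simpa using h

/-- The excess over `K` satisfies `(|t| - K)₊ * K ≤ t ^ 2`, so its square is at most `t ^ 4 / K ^
2`, and `t ^ 4 ≤ 32 exp (t ^ 2 / 4)`. This shape is used instead of a sharp cutoff because it is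
Lipschitz before squaring and so survives the passage from a net to the sphere. -/
lemma exists_integral_tail_le {ε : ℝ} (hε : 0 < ε) :
    ∃ K : ℝ, 0 < K ∧ ∫ t : ℝ, (max (|t| - K) 0) ^ 2 ∂(gaussianReal 0 1) ≤ ε := by
  refine ⟨Real.sqrt (64 / ε), by positivity, ?_⟩
  have hK : (0 : ℝ) < 64 / ε := by positivity
  have hle : ∀ t : ℝ, (max (|t| - Real.sqrt (64 / ε)) 0) ^ 2 ≤ ε / 2 * Real.exp (t ^ 2 / 4) := by
    intro t
    set K := Real.sqrt (64 / ε) with hKdef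
    have hKs : K ^ 2 = 64 / ε := Real.sq_sqrt hK.le
    have hK0 : 0 < K := by positivity
    have h1 : (max (|t| - K) 0) * K ≤ t ^ 2 := by
      rcases le_total (|t| - K) 0 with h | h
      · rw [max_eq_right h]; nlinarith
      · rw [max_eq_left h, ← sq_abs t]; nlinarith [abs_nonneg t]
    have h2 : ((max (|t| - K) 0) * K) ^ 2 ≤ (t ^ 2) ^ 2 := by gcongr
    have h3 := Real.quadratic_le_exp_of_nonneg (x := t ^ 2 / 4) (by positivity)
    rw [mul_pow, hKs, mul_div_assoc', div_le_iff₀ hε] at h2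
    nlinarith [sq_nonneg t]
  have hi : Integrable (fun t : ℝ => (max (|t| - Real.sqrt (64 / ε)) 0) ^ 2) (gaussianReal 0 1) := by
    refine (integrable_exp_sq_div_four.const_mul (ε / 2)).mono' (by fun_prop)
      (ae_of_all _ fun t => ?_)
    rw [Real.norm_of_nonneg (by positivity)]
    exact hle t
  refine (integral_mono hi (integrable_exp_sq_div_four.const_mul (ε / 2)) hle).trans ?_
  rw [integral_const_mul]
  nlinarith [integral_exp_sq_div_four_le]

/-- Continuity of the measure from above along the balls shrinking to `{0}`, which is a null set. -/
lemma exists_integral_indicator_le {ε : ℝ} (hε : 0 < ε) :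
    ∃ r : ℝ, 0 < r ∧ ∫ t : ℝ, (if |t| ≤ r then 1 else 0) ∂(gaussianReal 0 1) ≤ ε := by
  have h := tendsto_measure_cthickening_of_isClosed (μ := gaussianReal 0 1) (s := {(0 : ℝ)})
    ⟨1, one_pos, measure_ne_top _ _⟩ isClosed_singleton
  have h0 : gaussianReal 0 1 {(0 : ℝ)} = 0 := by
    have := nullSingletonClass_gaussianReal (μ := 0) (v := 1) one_ne_zero
    exact measure_singleton 0
  rw [h0] at h
  have h1 : ∀ᶠ r in nhdsWithin (0 : ℝ) (Set.Ioi 0),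
      gaussianReal 0 1 (Metric.cthickening r {(0 : ℝ)}) < ENNReal.ofReal ε :=
    (h.mono_left nhdsWithin_le_nhds).eventually_lt_const (ENNReal.ofReal_pos.2 hε)
  obtain ⟨r, hr, hr0⟩ := (h1.and self_mem_nhdsWithin).exists
  refine ⟨r, hr0, ?_⟩
  rw [Metric.cthickening_singleton _ (le_of_lt hr0)] at hr
  have h2 : (fun t : ℝ => if |t| ≤ r then (1 : ℝ) else 0)
      = (Metric.closedBall (0 : ℝ) r).indicator 1 := by
    funext t
    have ht : t ∈ Metric.closedBall (0 : ℝ) r ↔ |t| ≤ r := by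
      rw [mem_closedBall_zero_iff, Real.norm_eq_abs]
    by_cases h : |t| ≤ r
    · rw [if_pos h, Set.indicator_of_mem (ht.2 h), Pi.one_apply]
    · rw [if_neg h, Set.indicator_of_notMem (fun hc => h (ht.1 hc))]
  rw [h2, integral_indicator_one Metric.isClosed_closedBall.measurableSet]
  exact ENNReal.toReal_le_of_le_ofReal hε.le hr.le

lemma integrable_abs_gaussianReal : Integrable (fun t : ℝ => |t|) (gaussianReal 0 1) :=
  ((memLp_id_gaussianReal 1).integrable le_rfl).abs

lemma integral_abs_gaussianReal_pos : 0 < ∫ t : ℝ, |t| ∂(gaussianReal 0 1) := by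
  refine (integral_nonneg fun t => abs_nonneg t).lt_of_ne fun h => ?_
  have h1 := (integral_eq_zero_iff_of_nonneg (fun t => abs_nonneg t)
    integrable_abs_gaussianReal).1 h.symm
  have h2 : ∫ t : ℝ, t ^ 2 ∂(gaussianReal 0 1) = 0 := by
    refine integral_eq_zero_of_ae (h1.mono fun t ht => ?_)
    simpa using ht
  linarith [integral_sq_gaussianReal]

lemma integral_inner_sq (h : ℝⁿ) : ∫ v : ℝⁿ, (inner ℝ v h) ^ 2 ∂(stdGaussian ℝⁿ) = ‖h‖ ^ 2 := by
  have h1 := variance_dual_stdGaussian (innerSL ℝ h)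
  rw [variance_of_integral_eq_zero (by fun_prop) (integral_strongDual_stdGaussian _),
    innerSL_apply_norm] at h1
  simpa [real_inner_comm] using h1

lemma integral_inner_eq_zero (h : ℝⁿ) : ∫ v : ℝⁿ, inner ℝ v h ∂(stdGaussian ℝⁿ) = 0 := by
  have h1 := integral_strongDual_stdGaussian (innerSL ℝ h)
  simpa [real_inner_comm] using h1

lemma memLp_inner (h : ℝⁿ) : MemLp (fun v : ℝⁿ => inner ℝ v h) 2 (stdGaussian ℝⁿ) := by
  have h1 := (IsGaussian.memLp_dual (stdGaussian ℝⁿ) (innerSL ℝ h) 2 (by simp))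
  refine h1.ae_eq (ae_of_all _ fun v => ?_)
  simp [real_inner_comm]

/-- The truncated absolute value: `|t|` if `l < |t| < u`, and `0` otherwise. -/
noncomputable def truncAbs (l u t : ℝ) : ℝ := if l < |t| ∧ |t| < u then |t| else 0

@[fun_prop]
lemma measurable_truncAbs (l u : ℝ) : Measurable (truncAbs l u) := by
  unfold truncAbs
  have h : Measurable fun t : ℝ => |t| := by fun_prop
  exact Measurable.ite (p := fun t : ℝ => l < |t| ∧ |t| < u)
    ((measurableSet_lt measurable_const h).inter (measurableSet_lt h measurable_const))
    h measurable_const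

lemma truncAbs_nonneg (l u t : ℝ) : 0 ≤ truncAbs l u t := by
  unfold truncAbs; split_ifs <;> simp

lemma truncAbs_le {l u : ℝ} (hu : 0 ≤ u) (t : ℝ) : truncAbs l u t ≤ u := by
  unfold truncAbs; split_ifs with h
  · exact h.2.le
  · exact hu

/-- The second moment of the truncated absolute value against `t ^ 2`, the value of the
expected initialization matrix in the direction of the signal. -/
noncomputable def signalMoment (l u : ℝ) : ℝ :=
  ∫ t, truncAbs l u t * t ^ 2 ∂(gaussianReal 0 1)

/-- The mean of the truncated absolute value, the value of the expected initialization matrix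
in the directions orthogonal to the signal. -/
noncomputable def noiseMoment (l u : ℝ) : ℝ := ∫ t, truncAbs l u t ∂(gaussianReal 0 1)

/-- Split `g = c • e + h` with `h` orthogonal to `e`. The projections on `e` and `h` are
independent, so the cross term has mean 0 and the last term factors, with `‖h‖ ^ 2 = 1 - c ^ 2`. -/
lemma integral_truncAbs_mul_sq {e g : ℝⁿ} (he : ‖e‖ = 1) (hg : ‖g‖ = 1) {l u : ℝ} (hu : 0 ≤ u) :
    ∫ v : ℝⁿ, truncAbs l u (inner ℝ v e) * (inner ℝ v g) ^ 2 ∂(stdGaussian ℝⁿ)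
      = signalMoment l u * (inner ℝ g e) ^ 2 + noiseMoment l u * (1 - (inner ℝ g e) ^ 2) := by
  set c : ℝ := inner ℝ g e with hc
  set h : ℝⁿ := g - c • e with hh
  have heh : inner ℝ e h = 0 := by
    rw [hh, inner_sub_right, inner_smul_right, real_inner_self_eq_norm_sq, he, real_inner_comm]
    simp [hc]
  have hhn : ‖h‖ ^ 2 = 1 - c ^ 2 := by
    rw [hh, norm_sub_sq_real, inner_smul_right, norm_smul, he, hg, ← hc, Real.norm_eq_abs,
      mul_one, sq_abs]
    ring
  have hind := indepFun_inner heh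
  have hexp : ∀ v : ℝⁿ, truncAbs l u (inner ℝ v e) * (inner ℝ v g) ^ 2
      = c ^ 2 * (truncAbs l u (inner ℝ v e) * (inner ℝ v e) ^ 2)
        + 2 * c * (truncAbs l u (inner ℝ v e) * inner ℝ v e * inner ℝ v h)
        + truncAbs l u (inner ℝ v e) * (inner ℝ v h) ^ 2 := by
    intro v
    have : inner ℝ v g = c * inner ℝ v e + inner ℝ v h := by
      rw [hh, inner_sub_right, inner_smul_right]; ring
    rw [this]; ring
  have hb : ∀ v : ℝⁿ, ‖truncAbs l u (inner ℝ v e)‖ ≤ u := fun v => by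
    rw [Real.norm_of_nonneg (truncAbs_nonneg _ _ _)]; exact truncAbs_le hu _
  have hm : AEStronglyMeasurable (fun v : ℝⁿ => truncAbs l u (inner ℝ v e)) (stdGaussian ℝⁿ) := by
    have : Measurable (fun v : ℝⁿ => truncAbs l u (inner ℝ v e)) := by fun_prop
    exact this.aestronglyMeasurable
  have hi1 : Integrable (fun v : ℝⁿ => truncAbs l u (inner ℝ v e) * (inner ℝ v e) ^ 2)
      (stdGaussian ℝⁿ) := (memLp_inner e).integrable_sq.bdd_mul hm (ae_of_all _ hb)
  have hi2 : Integrable (fun v : ℝⁿ => truncAbs l u (inner ℝ v e) * inner ℝ v e * inner ℝ v h)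
      (stdGaussian ℝⁿ) := by
    have := ((memLp_inner e).integrable_mul (memLp_inner h)).bdd_mul hm (ae_of_all _ hb)
    simpa [mul_assoc] using this
  have hi3 : Integrable (fun v : ℝⁿ => truncAbs l u (inner ℝ v e) * (inner ℝ v h) ^ 2)
      (stdGaussian ℝⁿ) := (memLp_inner h).integrable_sq.bdd_mul hm (ae_of_all _ hb)
  simp_rw [hexp]
  rw [integral_add (f := fun v : ℝⁿ => _ + _) ((hi1.const_mul _).add (hi2.const_mul _)) hi3,
    integral_add (hi1.const_mul _) (hi2.const_mul _), integral_const_mul, integral_const_mul]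
  have e1 : ∫ v : ℝⁿ, truncAbs l u (inner ℝ v e) * (inner ℝ v e) ^ 2 ∂(stdGaussian ℝⁿ)
      = signalMoment l u :=
    integral_inner he (f := fun t => truncAbs l u t * t ^ 2) (by fun_prop)
  have e2 : ∫ v : ℝⁿ, truncAbs l u (inner ℝ v e) * inner ℝ v e * inner ℝ v h ∂(stdGaussian ℝⁿ)
      = 0 := by
    have := hind.integral_fun_comp_mul_comp (f := fun t => truncAbs l u t * t) (g := fun t => t)
      (by fun_prop) (by fun_prop) (by fun_prop) (by fun_prop)
    rw [integral_inner_eq_zero, mul_zero] at this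
    exact this
  have e3 : ∫ v : ℝⁿ, truncAbs l u (inner ℝ v e) * (inner ℝ v h) ^ 2 ∂(stdGaussian ℝⁿ)
      = noiseMoment l u * (1 - c ^ 2) := by
    have := hind.integral_fun_comp_mul_comp (f := fun t => truncAbs l u t) (g := fun t => t ^ 2)
      (by fun_prop) (by fun_prop) (by fun_prop) (by fun_prop)
    rw [integral_inner_sq, hhn, integral_inner he (by fun_prop)] at this
    exact this
  rw [e1, e2, e3]
  ring

lemma integral_truncated_eq {l u : ℝ} (hl : 0 ≤ l) (hlu : l ≤ u) (f : ℝ → ℝ) :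
    ∫ t : ℝ, (if l < |t| ∧ |t| < u then f |t| else 0) ∂(gaussianReal 0 1)
      = 2 * (Real.sqrt (2 * Real.pi))⁻¹ * ∫ s in l..u, f s * Real.exp (-s ^ 2 / 2) := by
  rw [integral_gaussianReal_eq_integral_smul one_ne_zero]
  have h1 : ∀ t : ℝ, gaussianPDFReal 0 1 t • (if l < |t| ∧ |t| < u then f |t| else 0)
      = (Set.Ioo l u).indicator
        (fun s => (Real.sqrt (2 * Real.pi))⁻¹ * (f s * Real.exp (-s ^ 2 / 2))) |t| := by
    intro t
    by_cases h : l < |t| ∧ |t| < u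
    · rw [if_pos h, Set.indicator_of_mem (show |t| ∈ Set.Ioo l u from h)]
      simp only [gaussianPDFReal, smul_eq_mul, NNReal.coe_one, mul_one, sub_zero, sq_abs]
      ring
    · rw [if_neg h, Set.indicator_of_notMem (show |t| ∉ Set.Ioo l u from h), smul_zero]
  simp_rw [h1]
  rw [integral_comp_abs (f := (Set.Ioo l u).indicator
        (fun s => (Real.sqrt (2 * Real.pi))⁻¹ * (f s * Real.exp (-s ^ 2 / 2)))),
    setIntegral_indicator measurableSet_Ioo]
  have h2 : Set.Ioi (0 : ℝ) ∩ Set.Ioo l u = Set.Ioo l u :=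
    Set.inter_eq_right.2 fun s hs => lt_of_le_of_lt hl hs.1
  rw [h2, integral_const_mul, intervalIntegral.integral_of_le hlu, integral_Ioc_eq_integral_Ioo]
  ring

lemma signalMoment_eq {l u : ℝ} (hl : 0 ≤ l) (hlu : l ≤ u) :
    signalMoment l u = 2 * (Real.sqrt (2 * Real.pi))⁻¹ *
      ∫ s in l..u, s ^ 3 * Real.exp (-s ^ 2 / 2) := by
  rw [← integral_truncated_eq hl hlu (fun s => s ^ 3), signalMoment]
  congr 1 with t
  unfold truncAbs
  split_ifs
  · rw [← sq_abs t]; ring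
  · simp

lemma noiseMoment_eq {l u : ℝ} (hl : 0 ≤ l) (hlu : l ≤ u) :
    noiseMoment l u = 2 * (Real.sqrt (2 * Real.pi))⁻¹ *
      ∫ s in l..u, s * Real.exp (-s ^ 2 / 2) := by
  rw [← integral_truncated_eq hl hlu (fun s => s), noiseMoment]
  rfl

/-- For admissible thresholds there is a spectral gap, which is stable under small relative
perturbations of the thresholds. -/
lemma exists_perturbed_moments {αl αu : ℝ} (h : AdmissibleThresholds αl αu) {τ : ℝ} (hτ : 0 < τ) :
    ∃ D : ℝ, 0 < D ∧ ∀ ε₀ : ℝ, 0 < ε₀ → ∃ ε : ℝ, 0 < ε ∧ ε ≤ ε₀ ∧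
      signalMoment (αl * (1 - ε)) (αu * (1 + ε)) - signalMoment (αl * (1 + ε)) (αu * (1 - ε))
        ≤ τ * D ∧
      D ≤ signalMoment (αl * (1 - ε)) (αu * (1 + ε)) - noiseMoment (αl * (1 - ε)) (αu * (1 + ε))
        := by
  obtain ⟨hl, hlu, hpos⟩ := h
  set κ : ℝ := 2 * (Real.sqrt (2 * Real.pi))⁻¹ with hκ
  have hκ0 : 0 < κ := by positivity
  have hc3 : Continuous fun s : ℝ => s ^ 3 * Real.exp (-s ^ 2 / 2) := by fun_prop
  have hc1 : Continuous fun s : ℝ => s * Real.exp (-s ^ 2 / 2) := by fun_prop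
  have hprim : ∀ {f : ℝ → ℝ}, Continuous f → ∀ {p q : ℝ → ℝ}, Continuous p → Continuous q →
      Continuous fun ε => ∫ s in (p ε)..(q ε), f s := by
    intro f hf p q hp hq
    have hF : Continuous fun x => ∫ s in (0 : ℝ)..x, f s :=
      intervalIntegral.continuous_primitive (fun a b => hf.intervalIntegrable a b) 0
    have : (fun ε => ∫ s in (p ε)..(q ε), f s)
        = fun ε => (∫ s in (0 : ℝ)..(q ε), f s) - ∫ s in (0 : ℝ)..(p ε), f s := by
      ext ε
      rw [intervalIntegral.integral_interval_sub_left (hf.intervalIntegrable _ _)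
        (hf.intervalIntegrable _ _)]
    rw [this]
    exact (hF.comp hq).sub (hF.comp hp)
  let A : ℝ → ℝ := fun ε => ∫ s in (αl * (1 - ε))..(αu * (1 + ε)), s ^ 3 * Real.exp (-s ^ 2 / 2)
  let B : ℝ → ℝ := fun ε => ∫ s in (αl * (1 + ε))..(αu * (1 - ε)), s ^ 3 * Real.exp (-s ^ 2 / 2)
  let C : ℝ → ℝ := fun ε => ∫ s in (αl * (1 - ε))..(αu * (1 + ε)), s * Real.exp (-s ^ 2 / 2)
  have hA : Continuous A := hprim hc3 (by fun_prop) (by fun_prop)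
  have hB : Continuous B := hprim hc3 (by fun_prop) (by fun_prop)
  have hC : Continuous C := hprim hc1 (by fun_prop) (by fun_prop)
  have hgap : 0 < κ * (A 0 - C 0) := by
    refine mul_pos hκ0 ?_
    simp only [A, C, sub_zero, add_zero, mul_one]
    rw [← intervalIntegral.integral_sub (hc3.intervalIntegrable _ _) (hc1.intervalIntegrable _ _)]
    simpa [sub_mul] using hpos
  -- Half of the unperturbed gap, so that by continuity the perturbed gap still exceeds `D` for
  -- small `ε`.
  set D := κ * (A 0 - C 0) / 2 with hD
  have hD0 : 0 < D := by positivity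
  refine ⟨D, hD0, fun ε₀ hε₀ => ?_⟩
  have ev1 : ∀ᶠ ε in nhds (0 : ℝ), κ * (A ε - B ε) < τ * D := by
    refine (by fun_prop : Continuous fun ε => κ * (A ε - B ε)).continuousAt.eventually_lt
      continuousAt_const ?_
    simp only [A, B, sub_zero, add_zero, sub_self, mul_zero]
    positivity
  have ev2 : ∀ᶠ ε in nhds (0 : ℝ), D < κ * (A ε - C ε) := by
    refine continuousAt_const.eventually_lt
      (by fun_prop : Continuous fun ε => κ * (A ε - C ε)).continuousAt ?_
    linarith
  have ev3 : ∀ᶠ ε in nhds (0 : ℝ), αl * (1 + ε) < αu * (1 - ε) := by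
    refine (by fun_prop : Continuous fun ε => αl * (1 + ε)).continuousAt.eventually_lt
      (by fun_prop : Continuous fun ε => αu * (1 - ε)).continuousAt ?_
    simpa using hlu
  have ev4 : ∀ᶠ ε in nhds (0 : ℝ), ε < min ε₀ 1 := eventually_lt_nhds (by positivity)
  have ev := ((ev1.and ev2).and (ev3.and ev4)).filter_mono
    (nhdsWithin_le_nhds (s := Set.Ioi (0 : ℝ)))
  obtain ⟨ε, ⟨⟨h1, h2⟩, h3, h4⟩, h5⟩ := (ev.and self_mem_nhdsWithin).exists
  have hε : 0 < ε := h5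
  have hε1 : ε < 1 := h4.trans_le (min_le_right _ _)
  have hl2 : 0 ≤ αl * (1 - ε) := mul_nonneg hl (by linarith)
  have hlu2 : αl * (1 - ε) ≤ αu * (1 + ε) := by nlinarith
  refine ⟨ε, hε, (h4.trans_le (min_le_left _ _)).le, ?_, ?_⟩
  · rw [signalMoment_eq hl2 hlu2, signalMoment_eq (mul_nonneg hl (by linarith)) h3.le, ← mul_sub]
    exact h1.le
  · rw [signalMoment_eq hl2 hlu2, noiseMoment_eq hl2 hlu2, ← mul_sub]
    exact h2.le

end Gaussian

/-! ### Events of overwhelming probability. -/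

section Events

universe v

/-- The property `Q a e` of a family `a` of `m` vectors of `ℝⁿ` and a unit vector `e` fails with
probability exponentially small in `m`, for independent standard Gaussian vectors `a` and
`m ≥ c₀ n`. -/
def HoldsWHP (Q : ∀ m n : ℕ, (Fin m → EuclideanSpace ℝ (Fin n)) → EuclideanSpace ℝ (Fin n) → Prop) :
    Prop :=
  ∃ c₀ c₁ c₂ : ℝ, 0 < c₀ ∧ 0 < c₁ ∧ 0 < c₂ ∧ ∀ (m n : ℕ) (e : EuclideanSpace ℝ (Fin n)),
    ‖e‖ = 1 → c₀ * n ≤ m → ∀ (Ω : Type v) [MeasurableSpace Ω] (P : Measure Ω)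
      [IsProbabilityMeasure P] (a : Fin m → Ω → EuclideanSpace ℝ (Fin n)),
      (∀ i, HasLaw (a i) (stdGaussian (EuclideanSpace ℝ (Fin n))) P) → iIndepFun a P →
      P.real {ω | ¬ Q m n (fun i => a i ω) e} ≤ c₁ * Real.exp (-c₂ * m)

lemma pos_of_norm_eq_one {n : ℕ} {e : EuclideanSpace ℝ (Fin n)} (he : ‖e‖ = 1) : 0 < n := by
  rcases Nat.eq_zero_or_pos n with rfl | h
  · rw [Subsingleton.elim e 0, norm_zero] at he
    exact absurd he zero_ne_one
  · exact h

variable {Q R : ∀ m n : ℕ, (Fin m → EuclideanSpace ℝ (Fin n)) → EuclideanSpace ℝ (Fin n) → Prop}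

/-- A unit vector forces `n ≥ 1`, hence `m ≥ c₀ n > 0`; this makes `0 < m` available to every
deterministic deduction. -/
lemma HoldsWHP.mono (hQ : HoldsWHP.{v} Q)
    (h : ∀ m n a e, 0 < m → ‖e‖ = 1 → Q m n a e → R m n a e) : HoldsWHP.{v} R := by
  obtain ⟨c₀, c₁, c₂, h₀, h₁, h₂, H⟩ := hQ
  refine ⟨c₀, c₁, c₂, h₀, h₁, h₂, fun m n e he hmn Ω _ P _ a ha hind => ?_⟩
  have hn : (0 : ℝ) < n := by exact_mod_cast pos_of_norm_eq_one he
  have hm : 0 < m := by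
    have : (0 : ℝ) < m := lt_of_lt_of_le (by positivity) hmn
    exact_mod_cast this
  refine (measureReal_mono ?_ (measure_ne_top _ _)).trans (H m n e he hmn Ω P a ha hind)
  exact fun ω hω hq => hω (h m n _ e hm he hq)

lemma HoldsWHP.and (hQ : HoldsWHP.{v} Q) (hR : HoldsWHP.{v} R) :
    HoldsWHP.{v} fun m n a e => Q m n a e ∧ R m n a e := by
  obtain ⟨c₀, c₁, c₂, h₀, h₁, h₂, H⟩ := hQ
  obtain ⟨d₀, d₁, d₂, k₀, k₁, k₂, K⟩ := hR
  refine ⟨max c₀ d₀, c₁ + d₁, min c₂ d₂, lt_max_of_lt_left h₀, by positivity, lt_min h₂ k₂,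
    fun m n e he hmn Ω _ P _ a ha hind => ?_⟩
  have h1 := H m n e he (le_trans (by gcongr; exact le_max_left _ _) hmn) Ω P a ha hind
  have h2 := K m n e he (le_trans (by gcongr; exact le_max_right _ _) hmn) Ω P a ha hind
  have hsub : {ω | ¬ (Q m n (fun i => a i ω) e ∧ R m n (fun i => a i ω) e)}
      ⊆ {ω | ¬ Q m n (fun i => a i ω) e} ∪ {ω | ¬ R m n (fun i => a i ω) e} := by
    intro ω hω
    by_cases hq : Q m n (fun i => a i ω) e
    · exact Or.inr fun hr => hω ⟨hq, hr⟩
    · exact Or.inl hq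
  calc _ ≤ _ := measureReal_mono hsub (measure_ne_top _ _)
    _ ≤ _ := measureReal_union_le _ _
    _ ≤ c₁ * Real.exp (-c₂ * m) + d₁ * Real.exp (-d₂ * m) := add_le_add h1 h2
    _ ≤ c₁ * Real.exp (-min c₂ d₂ * m) + d₁ * Real.exp (-min c₂ d₂ * m) := by
        gcongr
        · exact min_le_left _ _
        · exact min_le_right _ _
    _ = _ := by ring

lemma holdsWHP_sum_le {f : ∀ n : ℕ, EuclideanSpace ℝ (Fin n) → EuclideanSpace ℝ (Fin n) → ℝ}
    {b s M δ : ℝ} (hs : 0 < s) (hM : 0 < M) (hδ : 0 < δ)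
    (hf : ∀ n e, Measurable (f n e))
    (hint : ∀ n e, ‖e‖ = 1 → Integrable (fun v => Real.exp (s * |f n e v|)) (stdGaussian _) ∧
      ∫ v, Real.exp (s * |f n e v|) ∂(stdGaussian _) ≤ M)
    (hb : ∀ n e, ‖e‖ = 1 → ∫ v, f n e v ∂(stdGaussian _) ≤ b) :
    HoldsWHP.{v} fun m n a e => ∑ i, f n e (a i) ≤ m * (b + δ) := by
  refine ⟨1, 1, chernoffRate s M δ, one_pos, one_pos, chernoffRate_pos hs hM hδ,
    fun m n e he _ Ω _ P _ a ha hind => ?_⟩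
  rw [one_mul]
  refine (measureReal_mono ?_ (measure_ne_top _ _)).trans
    (measure_sum_ge_le_exp_chernoffRate ha hind hs hM hδ (hf n e) (hint n e he).1 (hint n e he).2
      (hb n e he))
  exact fun ω hω => (not_le.1 hω).le

lemma holdsWHP_le_sum {f : ∀ n : ℕ, EuclideanSpace ℝ (Fin n) → EuclideanSpace ℝ (Fin n) → ℝ}
    {b s M δ : ℝ} (hs : 0 < s) (hM : 0 < M) (hδ : 0 < δ)
    (hf : ∀ n e, Measurable (f n e))
    (hint : ∀ n e, ‖e‖ = 1 → Integrable (fun v => Real.exp (s * |f n e v|)) (stdGaussian _) ∧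
      ∫ v, Real.exp (s * |f n e v|) ∂(stdGaussian _) ≤ M)
    (hb : ∀ n e, ‖e‖ = 1 → b ≤ ∫ v, f n e v ∂(stdGaussian _)) :
    HoldsWHP.{v} fun m n a e => m * (b - δ) ≤ ∑ i, f n e (a i) := by
  refine (holdsWHP_sum_le (f := fun n e v => -f n e v) (b := -b) hs hM hδ
    (fun n e => (hf n e).neg) (by simpa using hint)
    (fun n e he => by rw [integral_neg]; exact neg_le_neg (hb n e he))).mono ?_
  intro m n a e _ _ h
  rw [Finset.sum_neg_distrib] at h
  linarith

/-- A net has at most `N ^ n` points, and for `m ≥ c₀ n` this count is absorbed by half of the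
exponential rate. What remains for each application is a deterministic comparison of `g` with a
nearby `s`. -/
lemma holdsWHP_net {ρ : ℝ} (hρ : 0 < ρ)
    {f : ∀ n : ℕ, EuclideanSpace ℝ (Fin n) → EuclideanSpace ℝ (Fin n) →
      EuclideanSpace ℝ (Fin n) → ℝ}
    {b : ∀ n : ℕ, EuclideanSpace ℝ (Fin n) → EuclideanSpace ℝ (Fin n) → ℝ}
    {W δ : ℝ} (hW : 0 < W) (hδ : 0 < δ)
    (hf : ∀ n e s, Measurable (f n e s))
    (hfW : ∀ n e s v, ‖e‖ = 1 → ‖s‖ = 1 → |f n e s v| ≤ W * (1 + (inner ℝ v s) ^ 2))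
    (hb : ∀ n e s, ‖e‖ = 1 → ‖s‖ = 1 → ∫ v, f n e s v ∂(stdGaussian _) ≤ b n e s) :
    HoldsWHP.{v} fun m n a e => ∀ g : EuclideanSpace ℝ (Fin n), ‖g‖ = 1 →
      ∃ s : EuclideanSpace ℝ (Fin n), ‖s‖ = 1 ∧ ‖g - s‖ ≤ ρ ∧
      ∑ i, f n e s (a i) ≤ m * (b n e s + δ) := by
  obtain ⟨N, hN, hnet⟩ := exists_net_sphere hρ
  have hc := quadraticRate_pos hW hδ
  -- The summand 1 keeps `c₀` positive when `N = 1`.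
  refine ⟨2 * Real.log N / quadraticRate W δ + 1, 1, quadraticRate W δ / 2, ?_, one_pos,
    half_pos hc, fun m n e he hmn Ω _ P _ a ha hind => ?_⟩
  · have : 0 ≤ Real.log N := Real.log_natCast_nonneg N
    positivity
  obtain ⟨T, hT, hT1, hTn⟩ := hnet n
  rw [one_mul]
  have hmn' : 2 * Real.log N / quadraticRate W δ * n ≤ m :=
    le_trans (by gcongr; linarith) hmn
  refine (measureReal_mono ?_ (measure_ne_top _ _)).trans (measure_exists_mem_le hN hc hmn' hT
    (B := fun s => {ω | m * (b n e s + δ) ≤ ∑ i, f n e s (a i ω)})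
    fun s hs => measure_sum_ge_le ha hind (hT1 s hs) (hf n e s) hW hδ
      (fun v => hfW n e s v he (hT1 s hs)) (hb n e s he (hT1 s hs)))
  intro ω hω
  by_contra hcon
  apply hω
  intro g hg
  obtain ⟨s, hs, hgs⟩ := hTn g hg
  refine ⟨s, hT1 s hs, hgs, ?_⟩
  by_contra h
  exact hcon ⟨s, hs, (not_le.1 h).le⟩

lemma add_sq_le_mul_add_mul (p q : ℝ) {t : ℝ} (ht : 0 < t) :
    (p + q) ^ 2 ≤ (1 + t) * p ^ 2 + (1 + 1 / t) * q ^ 2 := by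
  have h : (1 + t) * p ^ 2 + (1 + 1 / t) * q ^ 2 - (p + q) ^ 2 = (t * p - q) ^ 2 / t := by
    field_simp; ring
  have : 0 ≤ (t * p - q) ^ 2 / t := by positivity
  linarith

lemma le_mul_norm_sq_of_sphere {n m : ℕ} {a : Fin m → EuclideanSpace ℝ (Fin n)} {C : ℝ}
    (h : ∀ g, ‖g‖ = 1 → ∑ i, (inner ℝ (a i) g) ^ 2 ≤ C) (g : EuclideanSpace ℝ (Fin n)) :
    ∑ i, (inner ℝ (a i) g) ^ 2 ≤ C * ‖g‖ ^ 2 := by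
  by_cases hg : g = 0
  · simp [hg]
  have hg' : ‖g‖ ≠ 0 := norm_ne_zero_iff.2 hg
  have h1 := h (‖g‖⁻¹ • g) (norm_smul_inv_norm (𝕜 := ℝ) hg)
  simp only [inner_smul_right, mul_pow, ← Finset.mul_sum] at h1
  rw [inv_pow, inv_mul_eq_div, div_le_iff₀ (by positivity)] at h1
  exact h1

lemma mul_norm_sq_le_of_sphere {n m : ℕ} {a : Fin m → EuclideanSpace ℝ (Fin n)} {C : ℝ}
    (h : ∀ g, ‖g‖ = 1 → C ≤ ∑ i, (inner ℝ (a i) g) ^ 2) (g : EuclideanSpace ℝ (Fin n)) :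
    C * ‖g‖ ^ 2 ≤ ∑ i, (inner ℝ (a i) g) ^ 2 := by
  by_cases hg : g = 0
  · simp [hg]
  have hg' : ‖g‖ ≠ 0 := norm_ne_zero_iff.2 hg
  have h1 := h (‖g‖⁻¹ • g) (norm_smul_inv_norm (𝕜 := ℝ) hg)
  simp only [inner_smul_right, mul_pow, ← Finset.mul_sum] at h1
  rw [inv_pow, inv_mul_eq_div, le_div_iff₀ (by positivity)] at h1
  exact h1

/-- A self-bounding argument: at a maximizer on the sphere, with maximum `M`, a net point within `1
/ 2` gives `M ≤ 2 * (2 * m) + 2 * (M / 4)`. -/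
lemma holdsWHP_frame_upper : HoldsWHP.{v} fun m n a _ =>
    ∀ g : EuclideanSpace ℝ (Fin n), ∑ i, (inner ℝ (a i) g) ^ 2 ≤ 8 * m * ‖g‖ ^ 2 := by
  refine (holdsWHP_net (ρ := 1 / 2) (by norm_num) (f := fun n _ s v => (inner ℝ v s) ^ 2)
    (b := fun _ _ _ => 1) one_pos one_pos (fun n _ s => by fun_prop)
    (fun n _ s v _ _ => by rw [abs_of_nonneg (sq_nonneg _)]; linarith)
    (fun n _ s _ hs => by rw [integral_inner_sq, hs]; norm_num)).mono ?_
  intro m n a e hm he h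
  have hcont : Continuous fun g : EuclideanSpace ℝ (Fin n) => ∑ i, (inner ℝ (a i) g) ^ 2 := by
    fun_prop
  obtain ⟨g₀, hg₀, hmax⟩ := (isCompact_sphere (0 : EuclideanSpace ℝ (Fin n)) 1).exists_isMaxOn
    ⟨e, by simpa using he⟩ hcont.continuousOn
  set M := ∑ i, (inner ℝ (a i) g₀) ^ 2 with hM
  have hM1 : ∀ g, ‖g‖ = 1 → ∑ i, (inner ℝ (a i) g) ^ 2 ≤ M := fun g hg =>
    hmax (by simpa using hg)
  have hMg := le_mul_norm_sq_of_sphere hM1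
  obtain ⟨s, hs, hgs, hsum⟩ := h g₀ (by simpa using hg₀)
  have h1 : M ≤ 2 * ∑ i, (inner ℝ (a i) s) ^ 2 + 2 * ∑ i, (inner ℝ (a i) (g₀ - s)) ^ 2 := by
    rw [hM, Finset.mul_sum, Finset.mul_sum, ← Finset.sum_add_distrib]
    refine Finset.sum_le_sum fun i _ => ?_
    rw [inner_sub_right]
    nlinarith [sq_nonneg (inner ℝ (a i) s - (inner ℝ (a i) g₀ - inner ℝ (a i) s))]
  have hM0 : 0 ≤ M := Finset.sum_nonneg fun _ _ => sq_nonneg _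
  have h2 : ∑ i, (inner ℝ (a i) (g₀ - s)) ^ 2 ≤ M * (1 / 2) ^ 2 :=
    (hMg _).trans (by gcongr)
  have h3 : M ≤ 8 * m := by linarith
  intro g
  exact (hMg g).trans (by gcongr)

/-- On the net the sum is at least `3 m / 4`; the upper frame bound makes the error of passing to a
nearby `g` small. -/
lemma holdsWHP_frame_lower : HoldsWHP.{v} fun m n a _ =>
    ∀ g : EuclideanSpace ℝ (Fin n), (m / 2) * ‖g‖ ^ 2 ≤ ∑ i, (inner ℝ (a i) g) ^ 2 := by
  refine (holdsWHP_frame_upper.and (holdsWHP_net (ρ := 1 / 64) (by norm_num)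
    (f := fun n _ s v => -(inner ℝ v s) ^ 2)
    (b := fun _ _ _ => -1) (δ := 1 / 4) one_pos (by norm_num) (fun n _ s => by fun_prop)
    (fun n _ s v _ _ => by rw [abs_neg, abs_of_nonneg (sq_nonneg _)]; linarith)
    (fun n _ s _ hs => by rw [integral_neg, integral_inner_sq, hs]; norm_num))).mono ?_
  intro m n a e hm he ⟨hU, h⟩
  have hm' : (0 : ℝ) < m := by exact_mod_cast hm
  refine mul_norm_sq_le_of_sphere fun g hg => ?_
  obtain ⟨s, hs, hgs, hsum⟩ := h g hg
  rw [Finset.sum_neg_distrib] at hsum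
  have h1 : ∑ i, (inner ℝ (a i) s) ^ 2 ≤ (1 + 1 / 4) * ∑ i, (inner ℝ (a i) g) ^ 2
      + (1 + 1 / (1 / 4)) * ∑ i, (inner ℝ (a i) (g - s)) ^ 2 := by
    rw [Finset.mul_sum, Finset.mul_sum, ← Finset.sum_add_distrib]
    refine Finset.sum_le_sum fun i _ => ?_
    have := add_sq_le_mul_add_mul (inner ℝ (a i) g) (-inner ℝ (a i) (g - s))
      (t := 1 / 4) (by norm_num)
    rw [neg_sq] at this
    refine le_trans (le_of_eq ?_) this
    rw [inner_sub_right]; ring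
  have h2 : ∑ i, (inner ℝ (a i) (g - s)) ^ 2 ≤ 8 * m * (1 / 64) ^ 2 :=
    (hU _).trans (by gcongr)
  linarith

lemma max_sub_zero_sq_le (p q K : ℝ) :
    (max (|p| - K) 0) ^ 2 ≤ 2 * (max (|q| - K) 0) ^ 2 + 2 * (p - q) ^ 2 := by
  have h1 : max (|p| - K) 0 ≤ max (|q| - K) 0 + |p - q| := by
    refine max_le ?_ (by positivity)
    have := abs_sub_abs_le_abs_sub p q
    linarith [le_max_left (|q| - K) 0]
  calc (max (|p| - K) 0) ^ 2 ≤ (max (|q| - K) 0 + |p - q|) ^ 2 := by gcongr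
    _ ≤ 2 * (max (|q| - K) 0) ^ 2 + 2 * |p - q| ^ 2 := by
        nlinarith [sq_nonneg (max (|q| - K) 0 - |p - q|)]
    _ = _ := by rw [sq_abs]

/-- This separates the two directions: the indicator involves only the signal projection `q`, so it
needs no net, and the excess only `p`. For `|p| > 2 K` one has `|p| ≤ 2 (|p| - K)`. -/
lemma ite_sq_le {ν K p q : ℝ} (hK : 0 < K) (hν : 0 < ν) :
    (if |q| ≤ ν * |p| then p ^ 2 else 0)
      ≤ (2 * K) ^ 2 * (if |q| ≤ ν * (2 * K) then 1 else 0) + 4 * (max (|p| - K) 0) ^ 2 := by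
  by_cases hp : |p| ≤ 2 * K
  · by_cases hq : |q| ≤ ν * |p|
    · rw [if_pos hq, if_pos (hq.trans (by gcongr)), ← sq_abs p]
      have : |p| ^ 2 ≤ (2 * K) ^ 2 := by gcongr
      nlinarith [sq_nonneg (max (|p| - K) 0)]
    · rw [if_neg hq]
      split_ifs <;> positivity
  · have h1 : max (|p| - K) 0 = |p| - K := max_eq_left (by linarith)
    have h2 : (if |q| ≤ ν * |p| then p ^ 2 else 0) ≤ |p| ^ 2 := by
      split_ifs
      · rw [sq_abs]
      · positivity
    have h3 : (0 : ℝ) ≤ (2 * K) ^ 2 * (if |q| ≤ ν * (2 * K) then 1 else 0) := by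
      split_ifs <;> positivity
    rw [h1]
    nlinarith

lemma measurable_ite_abs_inner_le {n : ℕ} (e : EuclideanSpace ℝ (Fin n)) (r : ℝ) :
    Measurable fun v : EuclideanSpace ℝ (Fin n) => if |inner ℝ v e| ≤ r then (1 : ℝ) else 0 :=
  Measurable.ite (measurableSet_le (by fun_prop) measurable_const) measurable_const
    measurable_const

/-- Near the signal, the sign of few and small measurements differs from that of the signal. -/
lemma exists_holdsWHP_sign : ∃ ν : ℝ, 0 < ν ∧ HoldsWHP.{v} fun m n a e =>
    ∀ g : EuclideanSpace ℝ (Fin n), ‖g‖ = 1 →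
      ∑ i, (if |inner ℝ (a i) e| ≤ ν * |inner ℝ (a i) g| then (inner ℝ (a i) g) ^ 2 else 0)
        ≤ m / 8 := by
  obtain ⟨K, hK, hKint⟩ := exists_integral_tail_le (ε := 1 / 512) (by norm_num)
  have hη : 0 < 1 / (128 * K ^ 2) := by positivity
  obtain ⟨r, hr, hrint⟩ := exists_integral_indicator_le hη
  -- Chosen so that `ν * (2 * K) = r`. The indicator part then costs at most `m / 16`, and the tail
  -- part at most `4 * (2 / 256 + 16 / 64 ^ 2) * m < m / 16`.
  refine ⟨r / (2 * K), by positivity, ?_⟩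
  have hm : Measurable fun t : ℝ => if |t| ≤ r then (1 : ℝ) else 0 :=
    Measurable.ite (measurableSet_le (by fun_prop) measurable_const) measurable_const
      measurable_const
  have hcount := holdsWHP_sum_le.{v}
    (f := fun n e v => if |inner ℝ v e| ≤ r then (1 : ℝ) else 0) (b := 1 / (128 * K ^ 2))
    (s := 1 / (4 * 1)) (M := 4) (by norm_num) (by norm_num) hη
    (fun n e => measurable_ite_abs_inner_le e r)
    (fun n e he => integrable_exp_of_le_one_add_sq he (measurable_ite_abs_inner_le e r) one_pos
      fun v => by split_ifs <;> simp <;> positivity)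
    (fun n e he => by rw [integral_inner he (f := fun t => if |t| ≤ r then (1 : ℝ) else 0) hm]
                      exact hrint)
  have htail := holdsWHP_net.{v} (ρ := 1 / 64) (by norm_num)
    (f := fun n _ s v => (max (|inner ℝ v s| - K) 0) ^ 2) (b := fun _ _ _ => 1 / 512)
    (W := 1) (δ := 1 / 512) one_pos (by norm_num) (fun n _ s => by fun_prop)
    (fun n _ s v _ _ => by
      rw [abs_of_nonneg (sq_nonneg _), one_mul, ← sq_abs (inner ℝ v s)]
      have : max (|inner ℝ v s| - K) 0 ≤ |inner ℝ v s| := max_le (by linarith) (abs_nonneg _)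
      have : (max (|inner ℝ v s| - K) 0) ^ 2 ≤ |inner ℝ v s| ^ 2 := by gcongr
      linarith)
    (fun n _ s _ hs => by
      rw [integral_inner hs (f := fun t => (max (|t| - K) 0) ^ 2) (by fun_prop)]
      exact hKint)
  refine (holdsWHP_frame_upper.and (hcount.and htail)).mono ?_
  intro m n a e hm he ⟨hU, hc, ht⟩ g hg
  have hm' : (0 : ℝ) < m := by exact_mod_cast hm
  obtain ⟨s, hs, hgs, hsum⟩ := ht g hg
  have hν : r / (2 * K) * (2 * K) = r := by field_simp
  have h1 : ∑ i, (if |inner ℝ (a i) e| ≤ r / (2 * K) * |inner ℝ (a i) g|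
      then (inner ℝ (a i) g) ^ 2 else 0)
      ≤ (2 * K) ^ 2 * ∑ i, (if |inner ℝ (a i) e| ≤ r then (1 : ℝ) else 0)
        + 4 * (2 * ∑ i, (max (|inner ℝ (a i) s| - K) 0) ^ 2
          + 2 * ∑ i, (inner ℝ (a i) (g - s)) ^ 2) := by
    simp only [Finset.mul_sum, ← Finset.sum_add_distrib]
    refine Finset.sum_le_sum fun i _ => ?_
    have h2 := ite_sq_le (p := inner ℝ (a i) g) (q := inner ℝ (a i) e) hK
      (show 0 < r / (2 * K) by positivity)
    have h3 := max_sub_zero_sq_le (inner ℝ (a i) g) (inner ℝ (a i) s) K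
    rw [hν] at h2
    rw [inner_sub_right]
    linarith
  have h2 : ∑ i, (inner ℝ (a i) (g - s)) ^ 2 ≤ 8 * m * (1 / 64) ^ 2 :=
    (hU _).trans (by gcongr)
  have h3 : (2 * K) ^ 2 * ∑ i, (if |inner ℝ (a i) e| ≤ r then (1 : ℝ) else 0) ≤ m / 16 := by
    calc _ ≤ (2 * K) ^ 2 * (m * (1 / (128 * K ^ 2) + 1 / (128 * K ^ 2))) := by gcongr
      _ = m / 16 := by field_simp; norm_num
  linarith

/-- The mean absolute value of a standard Gaussian variable. -/
noncomputable def gaussianAbsMean : ℝ := ∫ t : ℝ, |t| ∂(gaussianReal 0 1)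

lemma holdsWHP_sum_abs_inner {δ : ℝ} (hδ : 0 < δ) : HoldsWHP.{v} fun m _ a e =>
    m * (gaussianAbsMean - δ) ≤ ∑ i, |inner ℝ (a i) e| ∧
      ∑ i, |inner ℝ (a i) e| ≤ m * (gaussianAbsMean + δ) := by
  have hmeas : ∀ (n : ℕ) (e : EuclideanSpace ℝ (Fin n)),
      Measurable fun v : EuclideanSpace ℝ (Fin n) => |inner ℝ v e| := fun n e => by fun_prop
  have hint := fun (n : ℕ) (e : EuclideanSpace ℝ (Fin n)) (he : ‖e‖ = 1) =>
    integrable_exp_of_le_one_add_sq he (hmeas n e) one_pos fun v => by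
      rw [abs_abs, one_mul, ← sq_abs]
      nlinarith [sq_nonneg (|inner ℝ v e| - 1)]
  have hmean : ∀ (n : ℕ) (e : EuclideanSpace ℝ (Fin n)), ‖e‖ = 1 →
      ∫ v, |inner ℝ v e| ∂(stdGaussian (EuclideanSpace ℝ (Fin n))) = gaussianAbsMean :=
    fun n e he => integral_inner he (f := fun t => |t|) (by fun_prop)
  exact (holdsWHP_le_sum (f := fun n e v => |inner ℝ v e|) (s := 1 / (4 * 1)) (M := 4)
    (by norm_num) (by norm_num) hδ hmeas hint fun n e he => (hmean n e he).ge).and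
    (holdsWHP_sum_le (f := fun n e v => |inner ℝ v e|) (s := 1 / (4 * 1)) (M := 4)
      (by norm_num) (by norm_num) hδ hmeas hint fun n e he => (hmean n e he).le)

/-- Dividing by `n` makes each summand an average of the absolute coordinates. By Jensen's
inequality its exponential moment is at most that of a single coordinate, so the rate does not
depend on `n`. -/
lemma holdsWHP_sum_l1Norm {δ : ℝ} (hδ : 0 < δ) : HoldsWHP.{v} fun m n a _ =>
    m * (gaussianAbsMean - δ) ≤ ∑ i, l1Norm (a i) / n ∧
      ∑ i, l1Norm (a i) / n ≤ m * (gaussianAbsMean + δ) := by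
  have hcoord : ∀ (n : ℕ) (j : Fin n) (v : EuclideanSpace ℝ (Fin n)),
      v j = inner ℝ v (EuclideanSpace.single j (1 : ℝ)) := fun n j v => by
    simp [EuclideanSpace.inner_single_right]
  have hunit : ∀ (n : ℕ) (j : Fin n), ‖EuclideanSpace.single j (1 : ℝ)‖ = 1 := fun n j => by simp
  have hmeas : ∀ (n : ℕ) (_ : EuclideanSpace ℝ (Fin n)),
      Measurable fun v : EuclideanSpace ℝ (Fin n) => l1Norm v / n := fun n e => by
    unfold l1Norm; fun_prop
  have hl1 : ∀ (n : ℕ) (v : EuclideanSpace ℝ (Fin n)), 0 ≤ l1Norm v :=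
    fun n v => Finset.sum_nonneg fun _ _ => abs_nonneg _
  have hcmeas : ∀ (n : ℕ) (j : Fin n),
      Measurable fun v : EuclideanSpace ℝ (Fin n) => |v j| := fun n j => by fun_prop
  have hbound : ∀ (n : ℕ) (j : Fin n) (v : EuclideanSpace ℝ (Fin n)),
      |(|v j|)| ≤ 1 * (1 + (inner ℝ v (EuclideanSpace.single j (1 : ℝ))) ^ 2) := fun n j v => by
    rw [← hcoord, abs_abs, one_mul, ← sq_abs]
    nlinarith [sq_nonneg (|v j| - 1)]
  have hc := fun (n : ℕ) (j : Fin n) =>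
    integrable_exp_of_le_one_add_sq (hunit n j) (hcmeas n j) one_pos (hbound n j)
  have hjensen : ∀ (n : ℕ), 0 < n → ∀ v : EuclideanSpace ℝ (Fin n),
      Real.exp (1 / (4 * 1) * |l1Norm v / n|)
        ≤ ∑ j : Fin n, (1 / n : ℝ) * Real.exp (1 / (4 * 1) * |(|v j|)|) := by
    intro n hn v
    have hn' : (0 : ℝ) < n := by exact_mod_cast hn
    have h := convexOn_exp.map_sum_le (t := Finset.univ) (w := fun _ : Fin n => (1 / n : ℝ))
      (p := fun j => 1 / (4 * 1) * |(|v j|)|) (fun _ _ => by positivity)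
      (by simp [hn'.ne']) (fun _ _ => Set.mem_univ _)
    simp only [smul_eq_mul] at h
    refine le_trans (le_of_eq ?_) h
    congr 1
    rw [abs_of_nonneg (div_nonneg (hl1 n v) hn'.le), l1Norm, Finset.sum_div, Finset.mul_sum]
    refine Finset.sum_congr rfl fun j _ => ?_
    rw [abs_abs]; ring
  have hint : ∀ (n : ℕ) (e : EuclideanSpace ℝ (Fin n)), ‖e‖ = 1 →
      Integrable (fun v => Real.exp (1 / (4 * 1) * |l1Norm v / n|))
        (stdGaussian (EuclideanSpace ℝ (Fin n))) ∧
      ∫ v, Real.exp (1 / (4 * 1) * |l1Norm v / n|)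
        ∂(stdGaussian (EuclideanSpace ℝ (Fin n))) ≤ 4 := by
    intro n e he
    have hn := pos_of_norm_eq_one he
    have hn' : (0 : ℝ) < n := by exact_mod_cast hn
    have hsum : Integrable (fun v : EuclideanSpace ℝ (Fin n) =>
        ∑ j : Fin n, (1 / n : ℝ) * Real.exp (1 / (4 * 1) * |(|v j|)|)) (stdGaussian _) :=
      integrable_finsetSum _ fun j _ => (hc n j).1.const_mul _
    have hi : Integrable (fun v => Real.exp (1 / (4 * 1) * |l1Norm v / n|))
        (stdGaussian (EuclideanSpace ℝ (Fin n))) := by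
      refine hsum.mono' ((hmeas n e).norm.const_mul _).exp.aestronglyMeasurable (ae_of_all _ fun v => ?_)
      rw [Real.norm_of_nonneg (Real.exp_pos _).le]
      exact hjensen n hn v
    refine ⟨hi, (integral_mono hi hsum (hjensen n hn)).trans ?_⟩
    rw [integral_finsetSum _ fun j _ => (hc n j).1.const_mul _]
    calc _ ≤ ∑ _j : Fin n, (1 / n : ℝ) * 4 := by
          refine Finset.sum_le_sum fun j _ => ?_
          rw [integral_const_mul]
          gcongr
          exact (hc n j).2
      _ = 4 := by simp; field_simp
  have hmean : ∀ (n : ℕ) (e : EuclideanSpace ℝ (Fin n)), ‖e‖ = 1 →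
      ∫ v, l1Norm v / n ∂(stdGaussian (EuclideanSpace ℝ (Fin n))) = gaussianAbsMean := by
    intro n e he
    have hn' : (n : ℝ) ≠ 0 := by exact_mod_cast (pos_of_norm_eq_one he).ne'
    have hj : ∀ j : Fin n, ∫ v : EuclideanSpace ℝ (Fin n), |v j| ∂(stdGaussian _)
        = gaussianAbsMean := fun j => by
      simp_rw [hcoord n j]
      exact integral_inner (hunit n j) (f := fun t => |t|) (by fun_prop)
    rw [integral_div]
    unfold l1Norm
    rw [integral_finsetSum _ fun j _ =>
      integrable_of_le_one_add_sq (hunit n j) (hcmeas n j) one_pos (hbound n j)]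
    simp_rw [hj]
    simp only [Finset.sum_const, Finset.card_univ, Fintype.card_fin, nsmul_eq_mul]
    field_simp
  exact (holdsWHP_le_sum (f := fun n _ v => l1Norm v / n) (s := 1 / (4 * 1)) (M := 4)
    (by norm_num) (by norm_num) hδ hmeas hint
    fun n e he => (hmean n e he).ge).and
    (holdsWHP_sum_le (f := fun n _ v => l1Norm v / n) (s := 1 / (4 * 1)) (M := 4)
    (by norm_num) (by norm_num) hδ hmeas hint
      fun n e he => (hmean n e he).le)

lemma abs_truncAbs_mul_sq_le {l u : ℝ} (hu : 0 < u) (t q : ℝ) :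
    |truncAbs l u t * q ^ 2| ≤ u * (1 + q ^ 2) := by
  rw [abs_of_nonneg (mul_nonneg (truncAbs_nonneg _ _ _) (sq_nonneg _))]
  have := truncAbs_le (l := l) hu.le t
  nlinarith [sq_nonneg q]

lemma measurable_truncAbs_mul_sq {n : ℕ} (l u : ℝ) (e g : EuclideanSpace ℝ (Fin n)) :
    Measurable fun v : EuclideanSpace ℝ (Fin n) =>
      truncAbs l u (inner ℝ v e) * (inner ℝ v g) ^ 2 := by
  fun_prop

lemma holdsWHP_signal_lower {l u δ : ℝ} (hu : 0 < u) (hδ : 0 < δ) : HoldsWHP.{v} fun m _ a e =>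
    m * (signalMoment l u - δ)
      ≤ ∑ i, truncAbs l u (inner ℝ (a i) e) * (inner ℝ (a i) e) ^ 2 :=
  holdsWHP_le_sum (f := fun n e v => truncAbs l u (inner ℝ v e) * (inner ℝ v e) ^ 2)
    (s := 1 / (4 * u)) (M := 4) (by positivity) (by norm_num) hδ
    (fun n e => measurable_truncAbs_mul_sq l u e e)
    (fun n e he => integrable_exp_of_le_one_add_sq he (measurable_truncAbs_mul_sq l u e e) hu
      fun v => abs_truncAbs_mul_sq_le hu _ _)
    (fun n e he => by
      rw [integral_truncAbs_mul_sq he he hu.le, real_inner_self_eq_norm_sq, he]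
      norm_num)

lemma sum_weighted_sq_le {n m : ℕ} {a : Fin m → EuclideanSpace ℝ (Fin n)} {w : Fin m → ℝ}
    {u t C : ℝ} (hw : ∀ i, 0 ≤ w i) (hwu : ∀ i, w i ≤ u) (ht : 0 < t)
    (hC : ∀ g, ∑ i, (inner ℝ (a i) g) ^ 2 ≤ C * ‖g‖ ^ 2) (hu : 0 ≤ u)
    (g s : EuclideanSpace ℝ (Fin n)) :
    ∑ i, w i * (inner ℝ (a i) g) ^ 2
      ≤ (1 + t) * ∑ i, w i * (inner ℝ (a i) s) ^ 2 + (1 + 1 / t) * (u * (C * ‖g - s‖ ^ 2)) := by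
  have h1 : ∑ i, w i * (inner ℝ (a i) g) ^ 2
      ≤ (1 + t) * ∑ i, w i * (inner ℝ (a i) s) ^ 2
        + (1 + 1 / t) * (u * ∑ i, (inner ℝ (a i) (g - s)) ^ 2) := by
    simp only [Finset.mul_sum, ← Finset.sum_add_distrib]
    refine Finset.sum_le_sum fun i _ => ?_
    have h2 := add_sq_le_mul_add_mul (inner ℝ (a i) s) (inner ℝ (a i) (g - s)) ht
    have h3 : inner ℝ (a i) s + inner ℝ (a i) (g - s) = inner ℝ (a i) g := by
      rw [inner_sub_right]; ring
    rw [h3] at h2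
    calc w i * (inner ℝ (a i) g) ^ 2
        ≤ w i * ((1 + t) * (inner ℝ (a i) s) ^ 2
          + (1 + 1 / t) * (inner ℝ (a i) (g - s)) ^ 2) := by
          gcongr; exact hw i
      _ = (1 + t) * (w i * (inner ℝ (a i) s) ^ 2)
          + (1 + 1 / t) * (w i * (inner ℝ (a i) (g - s)) ^ 2) := by ring
      _ ≤ _ := by gcongr; exact hwu i
  refine h1.trans ?_
  gcongr
  exact hC _

lemma abs_sq_inner_sub_sq_inner_le {n : ℕ} {e g s : EuclideanSpace ℝ (Fin n)} (he : ‖e‖ = 1)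
    (hg : ‖g‖ = 1) (hs : ‖s‖ = 1) :
    |(inner ℝ s e) ^ 2 - (inner ℝ g e) ^ 2| ≤ 2 * ‖g - s‖ := by
  have h1 : (inner ℝ s e) ^ 2 - (inner ℝ g e) ^ 2
      = inner ℝ (s - g) e * inner ℝ (s + g) e := by
    rw [inner_sub_left, inner_add_left]; ring
  rw [h1, abs_mul]
  have h2 : |inner ℝ (s - g) e| ≤ ‖g - s‖ := by
    have := abs_real_inner_le_norm (s - g) e
    rwa [he, mul_one, norm_sub_rev] at this
  have h3 : |inner ℝ (s + g) e| ≤ 2 := by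
    have := abs_real_inner_le_norm (s + g) e
    rw [he, mul_one] at this
    have := norm_add_le s g
    linarith
  nlinarith [abs_nonneg (inner ℝ (s - g) e), abs_nonneg (inner ℝ (s + g) e)]

/-- Uniform upper bound for the quadratic form of the initialization matrix. -/
lemma holdsWHP_quadratic_upper {l u δ : ℝ} (hu : 0 < u) (hδ : 0 < δ) : HoldsWHP.{v} fun m n a e =>
    ∀ g : EuclideanSpace ℝ (Fin n), ‖g‖ = 1 →
      ∑ i, truncAbs l u (inner ℝ (a i) e) * (inner ℝ (a i) g) ^ 2
        ≤ m * (signalMoment l u * (inner ℝ g e) ^ 2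
          + noiseMoment l u * (1 - (inner ℝ g e) ^ 2) + δ) := by
  set β := signalMoment l u
  set γ := noiseMoment l u
  set B := |β| + |γ| + 1 with hB
  have hB0 : 0 < B := by positivity
  -- Here `t` is the weight in Young's inequality and `ρ` below the mesh of the net. They are chosen
  -- so that inflating the main term costs `δ / 8`, the net values `5 δ / 8` and the frame error `δ
  -- / 8`, in total less than `δ`.
  set t := min 1 (δ / (8 * B)) with ht
  have ht0 : 0 < t := by positivity
  have ht1 : t ≤ 1 := min_le_left _ _
  have htB : t * B ≤ δ / 8 := by
    have : t ≤ δ / (8 * B) := min_le_right _ _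
    rw [le_div_iff₀ (by positivity)] at this
    linarith
  set ρ := min 1 (min (δ / (32 * B)) (δ / (64 * u * (1 + 1 / t)))) with hρ
  have hρ0 : 0 < ρ := by positivity
  have hρ1 : ρ ≤ 1 := min_le_left _ _
  have hρB : ρ * B ≤ δ / 32 := by
    have : ρ ≤ δ / (32 * B) := (min_le_right _ _).trans (min_le_left _ _)
    rw [le_div_iff₀ (by positivity)] at this
    linarith
  have hρu : (1 + 1 / t) * (u * 8) * ρ ≤ δ / 8 := by
    have : ρ ≤ δ / (64 * u * (1 + 1 / t)) := (min_le_right _ _).trans (min_le_right _ _)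
    rw [le_div_iff₀ (by positivity)] at this
    linarith
  refine (holdsWHP_frame_upper.and (holdsWHP_net hρ0
    (f := fun n e s v => truncAbs l u (inner ℝ v e) * (inner ℝ v s) ^ 2)
    (b := fun n e s => β * (inner ℝ s e) ^ 2 + γ * (1 - (inner ℝ s e) ^ 2))
    (W := u) (δ := δ / 4) hu (by positivity) (fun n e s => measurable_truncAbs_mul_sq l u e s)
    (fun n e s v _ _ => abs_truncAbs_mul_sq_le hu _ _)
    (fun n e s he hs => (integral_truncAbs_mul_sq he hs hu.le).le))).mono ?_
  intro m n a e hm he ⟨hU, h⟩ g hg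
  have hm' : (0 : ℝ) < m := by exact_mod_cast hm
  obtain ⟨s, hs, hgs, hsum⟩ := h g hg
  have h1 := sum_weighted_sq_le (w := fun i => truncAbs l u (inner ℝ (a i) e))
    (fun i => truncAbs_nonneg _ _ _) (fun i => truncAbs_le hu.le _) ht0 hU hu.le g s
  have h2 := abs_sq_inner_sub_sq_inner_le he hg hs
  have hp : (inner ℝ g e) ^ 2 ≤ 1 := by
    rw [← sq_abs]
    have := abs_real_inner_le_norm g e
    rw [he, hg, mul_one] at this
    nlinarith [abs_nonneg (inner ℝ g e)]
  set p := (inner ℝ g e) ^ 2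
  set q := (inner ℝ s e) ^ 2
  have hp0 : 0 ≤ p := sq_nonneg _
  have hQg : β * p + γ * (1 - p) ≤ B := by
    nlinarith [le_abs_self β, le_abs_self γ, abs_nonneg β, abs_nonneg γ]
  have hQs : β * q + γ * (1 - q) ≤ β * p + γ * (1 - p) + 2 * B * ρ := by
    have h3 : (β - γ) * (q - p) ≤ |β - γ| * |q - p| := by
      rw [← abs_mul]; exact le_abs_self _
    have h4 : |β - γ| ≤ B := (abs_sub _ _).trans (by linarith)
    have h5 : |β - γ| * |q - p| ≤ B * (2 * ρ) := by
      gcongr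
      linarith
    linarith
  have h3 : (1 + 1 / t) * (u * (8 * m * ‖g - s‖ ^ 2)) ≤ m * (δ / 8) := by
    have h4 : ‖g - s‖ ^ 2 ≤ ρ := by
      calc ‖g - s‖ ^ 2 ≤ ρ ^ 2 := by gcongr
        _ ≤ ρ := by nlinarith
    calc (1 + 1 / t) * (u * (8 * m * ‖g - s‖ ^ 2)) ≤ (1 + 1 / t) * (u * (8 * m * ρ)) := by gcongr
      _ = m * ((1 + 1 / t) * (u * 8) * ρ) := by ring
      _ ≤ _ := by gcongr
  calc _ ≤ (1 + t) * (m * (β * q + γ * (1 - q) + δ / 4)) + m * (δ / 8) := by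
        refine h1.trans ?_
        gcongr
    _ ≤ (1 + t) * (m * (β * p + γ * (1 - p) + 2 * B * ρ + δ / 4)) + m * (δ / 8) := by gcongr
    _ = m * (β * p + γ * (1 - p) + t * (β * p + γ * (1 - p))
          + (1 + t) * (2 * (ρ * B) + δ / 4) + δ / 8) := by ring
    _ ≤ m * (β * p + γ * (1 - p) + δ) := by
        refine mul_le_mul_of_nonneg_left ?_ hm'.le
        have h5 : t * (β * p + γ * (1 - p)) ≤ t * B := by gcongr
        have h6 : (1 + t) * (2 * (ρ * B) + δ / 4) ≤ 2 * (2 * (δ / 32) + δ / 4) := by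
          gcongr
          linarith
        linarith

end Events

/-! ### The variational property of the leading eigenvector. -/

section LeadingEigenvector

variable {n : ℕ}

/-- A leading eigenvector of a symmetric matrix maximizes the quadratic form on the unit
sphere. -/
lemma IsLeadingEigenvector.inner_le {Y : Matrix (Fin n) (Fin n) ℝ}
    {u : EuclideanSpace ℝ (Fin n)} (hY : Y.IsHermitian) (hu : IsLeadingEigenvector Y u)
    {g : EuclideanSpace ℝ (Fin n)} (hg : ‖g‖ = 1) :
    inner ℝ g (Matrix.toEuclideanLin Y g) ≤ inner ℝ u (Matrix.toEuclideanLin Y u) := by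
  obtain ⟨hu1, θ, hθ, hmax⟩ := hu
  set T := Matrix.toEuclideanLin Y with hT
  have hsymm : T.IsSymmetric := Matrix.isSymmetric_toEuclideanLin_iff.2 hY
  have hu2 : inner ℝ u (T u) = θ := by
    rw [hθ.apply_eq_smul, inner_smul_right, real_inner_self_eq_norm_sq, hu1]
    norm_num
  rw [hu2]
  have hn : Module.finrank ℝ (EuclideanSpace ℝ (Fin n)) = n := finrank_euclideanSpace_fin
  let b := hsymm.eigenvectorBasis hn
  -- In an orthonormal eigenbasis the form is a weighted average of eigenvalues, each at most `θ`.
  have hb : ∀ i, inner ℝ (b i) (T g) = hsymm.eigenvalues hn i * inner ℝ (b i) g := fun i => by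
    rw [← hsymm (b i) g, hsymm.apply_eigenvectorBasis hn i, inner_smul_left]
    simp [b]
  rw [← b.sum_inner_mul_inner g (T g)]
  calc ∑ i, inner ℝ g (b i) * inner ℝ (b i) (T g)
      ≤ ∑ i, θ * (inner ℝ g (b i) * inner ℝ (b i) g) := by
        refine Finset.sum_le_sum fun i _ => ?_
        rw [hb, real_inner_comm g (b i)]
        have h1 : hsymm.eigenvalues hn i ≤ θ := hmax _ (hsymm.hasEigenvalue_eigenvalues hn i)
        nlinarith [mul_self_nonneg (inner ℝ g (b i))]
    _ = θ := by
        rw [← Finset.mul_sum, b.sum_inner_mul_inner g g, real_inner_self_eq_norm_sq, hg]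
        norm_num

variable {m : ℕ}

lemma isHermitian_initMatrix (αl αu : ℝ) (a : Fin m → EuclideanSpace ℝ (Fin n)) (y : Fin m → ℝ) :
    (initMatrix αl αu a y).IsHermitian := by
  ext i j
  simp only [initMatrix, Matrix.conjTranspose_apply, Matrix.smul_apply, Matrix.sum_apply,
    star_trivial]
  congr 1
  refine Finset.sum_congr rfl fun k _ => ?_
  split_ifs
  · simp [Matrix.vecMulVec_apply, mul_comm]
  · simp

lemma inner_initMatrix (αl αu : ℝ) (a : Fin m → EuclideanSpace ℝ (Fin n)) (y : Fin m → ℝ)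
    (g : EuclideanSpace ℝ (Fin n)) :
    inner ℝ g (Matrix.toEuclideanLin (initMatrix αl αu a y) g)
      = (1 / m) * ∑ i, (if αl * normEstimate a y < y i ∧ y i < αu * normEstimate a y
          then y i else 0) * (inner ℝ (a i) g) ^ 2 := by
  unfold initMatrix
  rw [map_smul, LinearMap.smul_apply, inner_smul_right, map_sum, LinearMap.sum_apply, inner_sum]
  congr 1
  refine Finset.sum_congr rfl fun i _ => ?_
  have h1 : inner ℝ g (Matrix.toEuclideanLin (Matrix.vecMulVec (a i).ofLp (a i).ofLp) g)
      = (inner ℝ (a i) g) ^ 2 := by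
    have h2 : Matrix.toEuclideanLin (Matrix.vecMulVec (a i).ofLp (a i).ofLp) g
        = (inner ℝ (a i) g : ℝ) • a i := by
      ext j
      simp only [Matrix.toLpLin_apply, Matrix.mulVec, dotProduct, Matrix.vecMulVec_apply,
        PiLp.inner_apply, PiLp.smul_apply, smul_eq_mul, Finset.sum_mul]
      refine Finset.sum_congr rfl fun k _ => ?_
      simp
      ring
    rw [h2, inner_smul_right, real_inner_comm]
    ring
  split_ifs
  · rw [map_smul, LinearMap.smul_apply, inner_smul_right, h1]
  · simp

end LeadingEigenvector

/-! ### Accuracy of the spectral initialization. -/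

section Initialization

variable {m n : ℕ} {a : Fin m → EuclideanSpace ℝ (Fin n)} {e : EuclideanSpace ℝ (Fin n)}

lemma measurements_smul {N : ℝ} (hN : 0 ≤ N) (i : Fin m) :
    measurements a (N • e) i = N * |inner ℝ (a i) e| := by
  rw [measurements, inner_smul_right, abs_mul, abs_of_nonneg hN]

/-- The estimate equals `N * S / L` with `S` and `L` both near `m * κ`. The mean `κ` cancels, so its
value is never needed; relative errors `ε / 4` in both leave at most `ε` in the quotient. -/
lemma normEstimate_bounds {N κ ε : ℝ} (hN : 0 < N) (hm : 0 < m) (hn : 0 < n) (hκ : 0 < κ)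
    (hε : 0 < ε) (hε1 : ε ≤ 1)
    (hS : m * (κ - κ * (ε / 4)) ≤ ∑ i, |inner ℝ (a i) e| ∧
      ∑ i, |inner ℝ (a i) e| ≤ m * (κ + κ * (ε / 4)))
    (hL : m * (κ - κ * (ε / 4)) ≤ ∑ i, l1Norm (a i) / n ∧
      ∑ i, l1Norm (a i) / n ≤ m * (κ + κ * (ε / 4))) :
    N * (1 - ε) ≤ normEstimate a (measurements a (N • e)) ∧
      normEstimate a (measurements a (N • e)) ≤ N * (1 + ε) := by
  have hm' : (0 : ℝ) < m := by exact_mod_cast hm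
  have hn' : (0 : ℝ) < n := by exact_mod_cast hn
  set S := ∑ i, |inner ℝ (a i) e| with hSdef
  set L := ∑ i, l1Norm (a i) / n with hLdef
  have hmκ : 0 < m * κ := by positivity
  have hL0 : 0 < L := lt_of_lt_of_le (by nlinarith) hL.1
  have hL1 : ∑ i, l1Norm (a i) = n * L := by
    rw [hLdef, ← Finset.sum_div]; field_simp
  have heq : normEstimate a (measurements a (N • e)) = N * S / L := by
    simp only [normEstimate, measurements_smul hN.le, ← Finset.mul_sum, hL1]
    rw [← hSdef]
    field_simp
  rw [heq, le_div_iff₀ hL0, div_le_iff₀ hL0]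
  constructor
  · have : (1 - ε) * L ≤ S := by
      calc (1 - ε) * L ≤ (1 - ε) * (m * (κ + κ * (ε / 4))) :=
            mul_le_mul_of_nonneg_left hL.2 (by linarith)
        _ = m * κ * ((1 - ε) * (1 + ε / 4)) := by ring
        _ ≤ m * κ * (1 - ε / 4) := by gcongr; nlinarith
        _ ≤ S := by linarith [hS.1]
    nlinarith
  · have : S ≤ (1 + ε) * L := by
      calc S ≤ m * κ * (1 + ε / 4) := by linarith [hS.2]
        _ ≤ m * κ * ((1 + ε) * (1 - ε / 4)) := by gcongr; nlinarith
        _ = (1 + ε) * (m * (κ - κ * (ε / 4))) := by ring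
        _ ≤ (1 + ε) * L := mul_le_mul_of_nonneg_left hL.1 (by linarith)
    nlinarith

lemma truncAbs_mono {l u l' u' : ℝ} (hl : l' ≤ l) (hu : u ≤ u') (t : ℝ) :
    truncAbs l u t ≤ truncAbs l' u' t := by
  by_cases h : l < |t| ∧ |t| < u
  · have h' : l' < |t| ∧ |t| < u' := ⟨hl.trans_lt h.1, h.2.trans_le hu⟩
    simp only [truncAbs, if_pos h, if_pos h', le_refl]
  · simp only [truncAbs, if_neg h]
    exact truncAbs_nonneg l' u' t

/-- By homogeneity the scale `N` factors out, leaving thresholds that depend only on the ratio `r`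
of `λ₀` to the true norm. -/
lemma truncated_measurement_eq {N αl αu r : ℝ} (hN : 0 < N) (t : ℝ) :
    (if αl * (N * r) < N * |t| ∧ N * |t| < αu * (N * r) then N * |t| else 0)
      = N * truncAbs (αl * r) (αu * r) t := by
  have h : (αl * (N * r) < N * |t| ∧ N * |t| < αu * (N * r)) ↔
      (αl * r < |t| ∧ |t| < αu * r) := by
    rw [mul_left_comm αl, mul_left_comm αu, mul_lt_mul_iff_right₀ hN, mul_lt_mul_iff_right₀ hN]
  by_cases hh : αl * r < |t| ∧ |t| < αu * r
  · rw [if_pos (h.2 hh), truncAbs, if_pos hh]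
  · rw [if_neg (fun hc => hh (h.1 hc)), truncAbs, if_neg hh, mul_zero]

/-- The leading eigenvector of the initialization matrix correlates with the signal. -/
lemma one_sub_sq_inner_le {αl αu N ε δ β₁ β₂ γ₂ D τ : ℝ} {u : EuclideanSpace ℝ (Fin n)}
    (hl : 0 ≤ αl) (hlu : αl < αu) (hN : 0 < N) (hm : 0 < m) (he : ‖e‖ = 1)
    (hnorm : N * (1 - ε) ≤ normEstimate a (measurements a (N • e)) ∧
      normEstimate a (measurements a (N • e)) ≤ N * (1 + ε))
    (hlow : m * (β₁ - δ) ≤ ∑ i, truncAbs (αl * (1 + ε)) (αu * (1 - ε)) (inner ℝ (a i) e) *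
      (inner ℝ (a i) e) ^ 2)
    (hup : ∀ g : EuclideanSpace ℝ (Fin n), ‖g‖ = 1 →
      ∑ i, truncAbs (αl * (1 - ε)) (αu * (1 + ε)) (inner ℝ (a i) e) * (inner ℝ (a i) g) ^ 2
        ≤ m * (β₂ * (inner ℝ g e) ^ 2 + γ₂ * (1 - (inner ℝ g e) ^ 2) + δ))
    (hu : IsLeadingEigenvector (initMatrix αl αu a (measurements a (N • e))) u)
    (hβ : β₂ - β₁ ≤ τ * D) (hγ : D ≤ β₂ - γ₂) (hD : 0 < D) (hδ : 2 * δ ≤ τ * D) :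
    1 - (inner ℝ u e) ^ 2 ≤ 2 * τ := by
  have hm' : (0 : ℝ) < m := by exact_mod_cast hm
  obtain ⟨r, hr⟩ : ∃ r, normEstimate a (measurements a (N • e)) = N * r :=
    ⟨normEstimate a (measurements a (N • e)) / N, by field_simp⟩
  rw [hr] at hnorm
  have hr1 : 1 - ε ≤ r := le_of_mul_le_mul_left hnorm.1 hN
  have hr2 : r ≤ 1 + ε := le_of_mul_le_mul_left hnorm.2 hN
  have hq := hu.inner_le (isHermitian_initMatrix _ _ _ _) he
  simp only [inner_initMatrix, hr, measurements_smul hN.le, truncated_measurement_eq hN,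
    mul_assoc, ← Finset.mul_sum] at hq
  have hq2 := le_of_mul_le_mul_left (le_of_mul_le_mul_left hq (by positivity)) hN
  have hu0 : 0 ≤ αu := hl.trans hlu.le
  have h1 : ∑ i, truncAbs (αl * (1 + ε)) (αu * (1 - ε)) (inner ℝ (a i) e) *
      (inner ℝ (a i) e) ^ 2
      ≤ ∑ i, truncAbs (αl * r) (αu * r) (inner ℝ (a i) e) * (inner ℝ (a i) e) ^ 2 :=
    Finset.sum_le_sum fun i _ => mul_le_mul_of_nonneg_right
      (truncAbs_mono (by gcongr) (by gcongr) _) (sq_nonneg _)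
  have h2 : ∑ i, truncAbs (αl * r) (αu * r) (inner ℝ (a i) e) * (inner ℝ (a i) u) ^ 2
      ≤ ∑ i, truncAbs (αl * (1 - ε)) (αu * (1 + ε)) (inner ℝ (a i) e) *
        (inner ℝ (a i) u) ^ 2 :=
    Finset.sum_le_sum fun i _ => mul_le_mul_of_nonneg_right
      (truncAbs_mono (by gcongr) (by gcongr) _) (sq_nonneg _)
  -- Narrow window at `e` ≤ true form at `e` ≤ true form at `u` ≤ wide window at `u`. Only the two
  -- outer bounds are probabilistic, and neither involves the random ratio `r`.
  have h3 := le_of_mul_le_mul_left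
    (hlow.trans (h1.trans (hq2.trans (h2.trans (hup u hu.1))))) hm'
  have hp : (inner ℝ u e) ^ 2 ≤ 1 := by
    have := abs_real_inner_le_norm u e
    rw [he, hu.1, mul_one] at this
    rw [← sq_abs]
    nlinarith [abs_nonneg (inner ℝ u e)]
  have h4 : D * (1 - (inner ℝ u e) ^ 2) ≤ (β₂ - γ₂) * (1 - (inner ℝ u e) ^ 2) :=
    mul_le_mul_of_nonneg_right hγ (by linarith)
  have h5 : D * (1 - (inner ℝ u e) ^ 2) ≤ D * (2 * τ) := by linarith
  exact le_of_mul_le_mul_left h5 hD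

lemma dist_smul_le {N ν lam : ℝ} {u : EuclideanSpace ℝ (Fin n)} (hN : 0 < N) (hν : 0 < ν)
    (he : ‖e‖ = 1) (hu : ‖u‖ = 1) (hlam : |lam - N| ≤ N * (ν / 4))
    (h : 1 - (inner ℝ u e) ^ 2 ≤ ν ^ 2 / 8) :
    dist (lam • u) (N • e) ≤ ν * ‖N • e‖ := by
  have key : ∀ e' : EuclideanSpace ℝ (Fin n), ‖e'‖ = 1 → 0 ≤ inner ℝ u e' →
      1 - (inner ℝ u e') ^ 2 ≤ ν ^ 2 / 8 → ‖lam • u - N • e'‖ ≤ ν * N := by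
    intro e' he' h0 h1
    have hle : inner ℝ u e' ≤ 1 := by
      have := real_inner_le_norm u e'
      rwa [he', hu, mul_one] at this
    -- For `c = ⟨u, e'⟩` in `[0, 1]`, `‖u - e'‖ ^ 2 = 2 * (1 - c) ≤ 2 * (1 - c ^ 2) ≤ ν ^ 2 / 4`.
    have h2 : ‖u - e'‖ ≤ ν / 2 := by
      refine le_of_sq_le_sq ?_ (by positivity)
      rw [norm_sub_sq_real, hu, he']
      nlinarith
    have h3 : lam • u - N • e' = (lam - N) • u + N • (u - e') := by
      rw [sub_smul, smul_sub]; abel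
    rw [h3]
    calc _ ≤ ‖(lam - N) • u‖ + ‖N • (u - e')‖ := norm_add_le _ _
      _ = |lam - N| + N * ‖u - e'‖ := by
          rw [norm_smul, norm_smul, hu, mul_one, Real.norm_eq_abs, Real.norm_of_nonneg hN.le]
      _ ≤ N * (ν / 4) + N * (ν / 2) := by gcongr
      _ ≤ ν * N := by nlinarith [mul_pos hN hν]
  rw [norm_smul, he, mul_one, Real.norm_of_nonneg hN.le, dist]
  rcases le_total 0 (inner ℝ u e) with h0 | h0
  · exact (min_le_left _ _).trans (key e he h0 h)
  · refine (min_le_right _ _).trans ?_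
    have := key (-e) (by rwa [norm_neg]) (by rw [inner_neg_right]; linarith)
      (by rwa [inner_neg_right, neg_sq])
    rwa [smul_neg, sub_neg_eq_add] at this

end Initialization

/-! ### Linear convergence of the iterates. -/

section Iteration

variable {m n : ℕ} {a : Fin m → EuclideanSpace ℝ (Fin n)} {e : EuclideanSpace ℝ (Fin n)}

/-- Scaling `h` to the sphere turns the sign condition at distance at most `ν * N` into the one with
threshold `ν`. Only absolute measurements of `x` enter, so both signs of the signal are covered. -/
lemma sum_sign_le {N ν : ℝ} (hN : 0 < N) {x : EuclideanSpace ℝ (Fin n)}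
    (hx : ∀ i, |inner ℝ (a i) x| = N * |inner ℝ (a i) e|)
    (hS : ∀ g : EuclideanSpace ℝ (Fin n), ‖g‖ = 1 →
      ∑ i, (if |inner ℝ (a i) e| ≤ ν * |inner ℝ (a i) g| then (inner ℝ (a i) g) ^ 2 else 0)
        ≤ m / 8)
    {h : EuclideanSpace ℝ (Fin n)} (hh : ‖h‖ ≤ ν * N) :
    ∑ i, (if |inner ℝ (a i) x| ≤ |inner ℝ (a i) h| then (inner ℝ (a i) h) ^ 2 else 0)
      ≤ (m / 8) * ‖h‖ ^ 2 := by
  by_cases h0 : h = 0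
  · simp [h0]
  have hn : 0 < ‖h‖ := norm_pos_iff.2 h0
  set g := ‖h‖⁻¹ • h with hg
  have hg1 : ‖g‖ = 1 := norm_smul_inv_norm (𝕜 := ℝ) h0
  have hhg : h = ‖h‖ • g := by rw [hg, smul_smul, mul_inv_cancel₀ hn.ne', one_smul]
  have hin : ∀ i, inner ℝ (a i) h = ‖h‖ * inner ℝ (a i) g := fun i => by
    conv_lhs => rw [hhg]
    rw [inner_smul_right]
  have hle : ∀ i, (if |inner ℝ (a i) x| ≤ |inner ℝ (a i) h| then (inner ℝ (a i) h) ^ 2 else 0)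
      ≤ (if |inner ℝ (a i) e| ≤ ν * |inner ℝ (a i) g| then (inner ℝ (a i) g) ^ 2 else 0)
        * ‖h‖ ^ 2 := by
    intro i
    by_cases hc : |inner ℝ (a i) x| ≤ |inner ℝ (a i) h|
    · have hc' : |inner ℝ (a i) e| ≤ ν * |inner ℝ (a i) g| := by
        rw [hx, hin, abs_mul, abs_norm] at hc
        refine le_of_mul_le_mul_left (hc.trans ?_) hN
        calc ‖h‖ * |inner ℝ (a i) g| ≤ ν * N * |inner ℝ (a i) g| := by gcongr
          _ = _ := by ring
      rw [if_pos hc, if_pos hc', hin]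
      exact le_of_eq (by ring)
    · rw [if_neg hc]
      split_ifs <;> positivity
  calc _ ≤ _ := Finset.sum_le_sum fun i _ => hle i
    _ = _ := (Finset.sum_mul _ _ _).symm
    _ ≤ _ := by gcongr; exact hS g hg1

lemma dist_iterate_le {N ν μ : ℝ} (hm : 0 < m) (he : ‖e‖ = 1) (hN : 0 < N) (hν : 0 < ν)
    (hμ : 0 < μ) (hμ' : μ < 1 / 2304)
    (hU : ∀ g, ∑ i, (inner ℝ (a i) g) ^ 2 ≤ 8 * m * ‖g‖ ^ 2)
    (hL : ∀ g, (m / 2) * ‖g‖ ^ 2 ≤ ∑ i, (inner ℝ (a i) g) ^ 2)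
    (hS : ∀ g : EuclideanSpace ℝ (Fin n), ‖g‖ = 1 →
      ∑ i, (if |inner ℝ (a i) e| ≤ ν * |inner ℝ (a i) g| then (inner ℝ (a i) g) ^ 2 else 0)
        ≤ m / 8)
    {u : EuclideanSpace ℝ (Fin n)}
    (h0 : dist (iterate μ a (measurements a (N • e)) u 0) (N • e) ≤ ν * ‖N • e‖) (t : ℕ) :
    dist (iterate μ a (measurements a (N • e)) u t) (N • e)
      ≤ ν * (1 - 1 / 8 * μ) ^ t * ‖N • e‖ := by
  have hnorm : ‖N • e‖ = N := by rw [norm_smul, he, mul_one, Real.norm_of_nonneg hN.le]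
  have hρ0 : 0 ≤ 1 - 1 / 8 * μ := by linarith
  have hρ1 : 1 - 1 / 8 * μ ≤ 1 := by linarith
  rw [hnorm] at h0 ⊢
  have hpow : ∀ t : ℕ, ν * (1 - 1 / 8 * μ) ^ t * N ≤ ν * N := fun t => by
    have := pow_le_one₀ (n := t) hρ0 hρ1
    nlinarith [mul_pos hν hN]
  -- The measurements do not see the sign, so the target can be fixed once as the nearer of `±N • e`
  -- at time 0. Contraction keeps every later iterate within `ν * N` of it.
  have key : ∀ x' : EuclideanSpace ℝ (Fin n),
      (∀ i, |inner ℝ (a i) x'| = N * |inner ℝ (a i) e|) →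
      ‖iterate μ a (measurements a (N • e)) u 0 - x'‖ ≤ ν * N → ∀ t,
      ‖iterate μ a (measurements a (N • e)) u t - x'‖ ≤ ν * (1 - 1 / 8 * μ) ^ t * N := by
    intro x' hx' h0' t
    induction t with
    | zero => simpa using h0'
    | succ t ih =>
      have h1 := norm_sub_smul_grad_sub_le (a := a) (y := measurements a (N • e)) (x := x')
        (z := iterate μ a (measurements a (N • e)) u t) hm hμ hμ'
        (fun i => by rw [measurements_smul hN.le, hx']) hU hL
        (sum_sign_le hN hx' hS (ih.trans (hpow t)))
      refine h1.trans ?_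
      calc _ ≤ (1 - 1 / 8 * μ) * (ν * (1 - 1 / 8 * μ) ^ t * N) := by gcongr
        _ = _ := by ring
  rcases min_le_iff.1 h0 with h | h
  · refine (min_le_left _ _).trans (key _ (fun i => ?_) h t)
    rw [inner_smul_right, abs_mul, abs_of_pos hN]
  · rw [← sub_neg_eq_add] at h
    refine (min_le_right _ _).trans ?_
    rw [← sub_neg_eq_add]
    refine key _ (fun i => ?_) h t
    rw [inner_neg_right, abs_neg, inner_smul_right, abs_mul, abs_of_pos hN]

lemma iterate_zero_signal (μ : ℝ) (u : EuclideanSpace ℝ (Fin n)) (t : ℕ) :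
    iterate μ a (measurements a 0) u t = 0 := by
  have h : ∀ i, measurements a (0 : EuclideanSpace ℝ (Fin n)) i = 0 := fun i => by
    simp [measurements]
  induction t with
  | zero => simp [iterate, normEstimate, h]
  | succ t ih => simp [iterate, ih, grad]

end Iteration

-- Assembly of the estimates.

universe v

/-- With high probability the iterates converge linearly for all signals in a given direction. -/
lemma holdsWHP_convergence {αl αu ν : ℝ} (hα : AdmissibleThresholds αl αu) (hν : 0 < ν)
    (hν1 : ν ≤ 1 / 2)
    (hsign : HoldsWHP.{v} fun m n a e => ∀ g : EuclideanSpace ℝ (Fin n), ‖g‖ = 1 →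
      ∑ i, (if |inner ℝ (a i) e| ≤ ν * |inner ℝ (a i) g| then (inner ℝ (a i) g) ^ 2 else 0)
        ≤ m / 8) :
    HoldsWHP.{v} fun _ n a e => ∀ N μ : ℝ, 0 < N → 0 < μ → μ < 1 / 2304 →
      ∀ u : EuclideanSpace ℝ (Fin n),
        IsLeadingEigenvector (initMatrix αl αu a (measurements a (N • e))) u → ∀ t : ℕ,
          dist (iterate μ a (measurements a (N • e)) u t) (N • e)
            ≤ ν * (1 - 1 / 8 * μ) ^ t * ‖N • e‖ := by
  -- The misalignment bound `2 * τ` is then the `ν ^ 2 / 8` required by `dist_smul_le`; likewise `ε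
  -- ≤ ν / 4` controls the error of the norm estimate.
  set τ := ν ^ 2 / 16 with hτ
  have hτ0 : 0 < τ := by positivity
  obtain ⟨D, hD, hpert⟩ := exists_perturbed_moments hα hτ0
  obtain ⟨ε, hε, hεν, hβ, hγ⟩ := hpert (ν / 4) (by positivity)
  obtain ⟨hl, hlu, -⟩ := hα
  have hu : 0 < αu := hl.trans_lt hlu
  have hκ : 0 < gaussianAbsMean := integral_abs_gaussianReal_pos
  have hδ : 0 < τ * D / 2 := by positivity
  have hκε : 0 < gaussianAbsMean * (ε / 4) := by positivity
  have hε1 : ε ≤ 1 := by linarith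
  refine ((holdsWHP_frame_upper.and (holdsWHP_frame_lower.and hsign)).and
    (((holdsWHP_sum_abs_inner hκε).and (holdsWHP_sum_l1Norm hκε)).and
      ((holdsWHP_signal_lower (l := αl * (1 + ε)) (u := αu * (1 - ε))
        (mul_pos hu (by linarith)) hδ).and
        (holdsWHP_quadratic_upper (l := αl * (1 - ε)) (u := αu * (1 + ε))
          (by positivity) hδ)))).mono ?_
  rintro m n a e hm he ⟨⟨hU, hL, hS⟩, ⟨hA, hB⟩, hlow, hup⟩ N μ hN hμ hμ' u hu t
  have hnorm := normEstimate_bounds hN hm (pos_of_norm_eq_one he) hκ hε hε1 hA hB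
  refine dist_iterate_le hm he hN hν hμ hμ' hU hL hS ?_ t
  refine dist_smul_le hN hν he hu.1 ?_ ?_
  · rw [abs_le]
    constructor <;> nlinarith
  · refine (one_sub_sq_inner_le hl hlu hN hm he hnorm hlow hup hu hβ hγ hD (by linarith)).trans ?_
    rw [hτ]; linarith

/-- The failure set, which quantifies over eigenvectors and step sizes, need not be measurable; its
measurable hull has the same outer measure. -/
lemma exists_measurableSet_compl {Ω : Type*} [MeasurableSpace Ω] (P : Measure Ω)
    [IsProbabilityMeasure P] {Q : Ω → Prop} {p : ℝ} (h : P.real {ω | ¬ Q ω} ≤ p) :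
    ∃ E : Set Ω, MeasurableSet E ∧ 1 - p ≤ P.real E ∧ ∀ ω ∈ E, Q ω := by
  refine ⟨(toMeasurable P {ω | ¬ Q ω})ᶜ, (measurableSet_toMeasurable _ _).compl, ?_, ?_⟩
  · rw [probReal_compl_eq_one_sub (measurableSet_toMeasurable _ _), measureReal_def,
      measure_toMeasurable]
    exact sub_le_sub_left h 1
  · intro ω hω
    by_contra hq
    exact hω (subset_toMeasurable P _ hq)

end RWF

theorem theorem1 :
    ∃ μ₀ ν lam : ℝ, 0 < μ₀ ∧ 0 < ν ∧ ν < 1 ∧ 0 < lam ∧ lam * μ₀ < 1 ∧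
      ∀ αl αu : ℝ, RWF.AdmissibleThresholds αl αu →
        ∃ c₀ c₁ c₂ : ℝ, 0 < c₀ ∧ 0 < c₁ ∧ 0 < c₂ ∧
          ∀ (m n : ℕ) (x : EuclideanSpace ℝ (Fin n)) (μ : ℝ),
            c₀ * n ≤ m → 0 < μ → μ < μ₀ →
            ∀ (Ω : Type*) [MeasurableSpace Ω] (P : Measure Ω) [IsProbabilityMeasure P]
              (a : Fin m → Ω → EuclideanSpace ℝ (Fin n)),
              (∀ i, HasLaw (a i) (stdGaussian (EuclideanSpace ℝ (Fin n))) P) →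
              iIndepFun a P →
              ∃ E : Set Ω, MeasurableSet E ∧
                1 - c₁ * Real.exp (-c₂ * m) ≤ P.real E ∧
                ∀ ω ∈ E, ∀ u : EuclideanSpace ℝ (Fin n),
                  RWF.IsLeadingEigenvector
                    (RWF.initMatrix αl αu (fun i => a i ω)
                      (RWF.measurements (fun i => a i ω) x)) u →
                  ∀ t : ℕ,
                    RWF.dist
                        (RWF.iterate μ (fun i => a i ω)
                          (RWF.measurements (fun i => a i ω) x) u t) x
                      ≤ ν * (1 - lam * μ) ^ t * ‖x‖ := by
  obtain ⟨ν₀, hν₀, hsign⟩ := RWF.exists_holdsWHP_sign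
  have hν : 0 < min ν₀ (1 / 2) := by positivity
  refine ⟨1 / 2304, min ν₀ (1 / 2), 1 / 8, by norm_num, hν,
    (min_le_right _ _).trans_lt (by norm_num), by norm_num, by norm_num, fun αl αu hα => ?_⟩
  -- Decreasing `ν` only removes terms from the sum, so `ν < 1` can be arranged.
  have hsign' := hsign.mono (R := fun m n a e => ∀ g : EuclideanSpace ℝ (Fin n), ‖g‖ = 1 →
      ∑ i, (if |inner ℝ (a i) e| ≤ min ν₀ (1 / 2) * |inner ℝ (a i) g|
        then (inner ℝ (a i) g) ^ 2 else 0) ≤ m / 8) (by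
    intro m n a e _ _ h g hg
    refine (Finset.sum_le_sum fun i _ => ?_).trans (h g hg)
    by_cases hc : |inner ℝ (a i) e| ≤ min ν₀ (1 / 2) * |inner ℝ (a i) g|
    · rw [if_pos hc, if_pos (hc.trans (by gcongr; exact min_le_left _ _))]
    · rw [if_neg hc]
      split_ifs <;> positivity)
  obtain ⟨c₀, c₁, c₂, h₀, h₁, h₂, H⟩ :=
    RWF.holdsWHP_convergence hα hν (min_le_right _ _) hsign'
  refine ⟨c₀, c₁, c₂, h₀, h₁, h₂, fun m n x μ hmn hμ hμ' Ω _ P _ a ha hind => ?_⟩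
  -- For `x = 0` there is no direction `e`, but all measurements vanish, hence `λ₀ = 0` and the
  -- iterates stay at 0.
  rcases eq_or_ne x 0 with rfl | hx
  · refine ⟨Set.univ, MeasurableSet.univ, ?_, fun ω _ u _ t => ?_⟩
    · rw [probReal_univ]
      have : 0 < c₁ * Real.exp (-c₂ * m) := by positivity
      linarith
    · rw [RWF.iterate_zero_signal]
      simp [RWF.dist]
  · have hx' : 0 < ‖x‖ := norm_pos_iff.2 hx
    have hxe : ‖x‖ • (‖x‖⁻¹ • x) = x := by
      rw [smul_smul, mul_inv_cancel₀ hx'.ne', one_smul]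
    obtain ⟨E, hE, hPE, hEQ⟩ := RWF.exists_measurableSet_compl P
      (H m n (‖x‖⁻¹ • x) (norm_smul_inv_norm (𝕜 := ℝ) hx) hmn Ω P a ha hind)
    refine ⟨E, hE, hPE, fun ω hω u hu t => ?_⟩
    have h := hEQ ω hω ‖x‖ μ hx' hμ hμ' u
    rw [hxe] at h
    exact h hu t
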